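/- **Setting.** Let $d\ge 1$, $b\ge 2$, $s\ge 0$ be integers. For $j=1,\dots,s$ let $X^{(j)}\subset\mathbb{R}^d$ be bounded with volume $1$, and let a recursive $b$-fold split of $X^{(j)}$ be given: Borel cells $X_{j,(k,t)}$ ($k\ge 0$, $0\le t<b^k$) with $X_{j,(0,0)}=X^{(j)}$, each level-$k$ cell being the union of its $b$ child cells $X_{j,(k,t,c)}$ ($0\le c<b$) of level $k+1$, which have equal volume and pairwise intersections of volume $0$. Suppose that for some $1\le C<\infty$ every level-$k$ cell has Euclidean diameter at most $Cb^{-k/d}$ (such splits are automatically convergent). Put $X^{1:s}=\prod_j X^{(j)}\subset\mathbb{R}^{ds}$ and let $f:X^{1:s}\to\mathbb{R}$. For $u\subseteq\{1,\dots,s\}$ let the ANOVA component be $$f_u(x)=\int_{\prod_{j\notin u}X^{(j)}}\Bigl(f(x)-\sum_{v\subsetneq u}f_v(x)\Bigr)\,dx_{-u}.$$ Let $\psi_{j,ktc}=b^{(k+1)/2}1_{X_{j,(k,t,c)}}-b^{(k-1)/2}1_{X_{j,(k,t)}}$, and for $\kappa=(k_j)_{j\in u}$ with $k_j\in\{0,1,\dots\}$,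 $\tau=(t_j)_{j\in u}$ with $0\le t_j<b^{k_j}$ and $\gamma=(c_j)_{j\in u}$ with $0\le c_j<b$, let $\psi_{u\kappa\tau\gamma}(x)=\prod_{j\in u}\psi_{j,k_jt_jc_j}(x_j)$, and $$\nu_{u\kappa}=\sum_{\tau}\sum_{\gamma}\langle f,\psi_{u\kappa\tau\gamma}\rangle\,\psi_{u\kappa\tau\gamma},\qquad \sigma_{u\kappa}^2=\int_{X^{1:s}}\nu_{u\kappa}(x)^2\,dx,\qquad |\kappa|=\sum_{j\in u}k_j .$$ Let $S_j=\{(j-1)d+1,\dots,jd\}$, $S_u=\bigcup_{j\in u}S_j$, and $\mathbb{S}_u=\{T\subseteq S_u: T\cap S_j\neq\emptyset\ \forall j\in u\}$. For $v\subseteq\{1,\dots,ds\}$, $\partial^v$ denotes the mixed partial derivative taken once in each coordinate of $v$, with value $0$ where it does not exist. Let $\mathrm{rect}(A)$ be the bounding box of $A$, and let $\widetilde{\mathbb{B}}_{u\kappa\tau}$ be the bounding box of $\prod_{j\in u}X_{j,(k_j,t_j)}\times\prod_{j\notin u}X^{(j)}$. Assume one of the following. 1. $X^{1:s}$ is Sobol'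 extensible with anchor $c$, that is, $X^{1:s}$ is closed with non-empty interior, $c\in X^{1:s}$, and $\mathrm{rect}\{c,z\}\subseteq X^{1:s}$ for all $z\in X^{1:s}$; $f$ is smooth, that is, all $\partial^v f$ exist and are continuous on $X^{1:s}$; and $\tilde f_u$ is the Sobol' extension $$\tilde f_u(x)=\sum_{w\subseteq\{1,\dots,ds\}}\int_{[c_w,x_w]}\partial^w f_u(c_{-w}{:}y_w)\,1_{c_{-w}{:}y_w\in X^{1:s}}\,dy_w,$$ where $c_{-w}{:}y_w$ has coordinates $y_\ell$ for $\ell\in w$ and $c_\ell$ for $\ell\notin w$, and $\int_{[c_w,x_w]}$ is the integral over $\mathrm{rect}\{c_w,x_w\}$, with a minus sign if $c_\ell>x_\ell$ for an odd number of $\ell\in w$. 2. Each $X^{(j)}$ is closed with non-empty interior and boundary of measure zero; $f\in C^{ds}(X^{1:s})$, that is, all partial derivatives of $f$ of total order at most $ds$ exist and are continuous on $X^{1:s}$; and $\tilde f_u\in C^{ds}(\mathrm{rect}(X^{1:s}))$ is a function that agrees with $f_u$ on $X^{1:s}$ (for example, the Whitney extension of $f_u$). **Claim.** Let $h_u(z)=\max_{v\in\mathbb{S}_u}|\partial^v\tilde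 f_u(z)|$ and let $\|h_u\|_\infty$ be its essential supremum over $\bigcup_\tau\widetilde{\mathbb{B}}_{u\kappa\tau}$. Then, for every $u\subseteq\{1,\dots,s\}$ and every $\kappa$, $$\sigma_{u\kappa}^2\le\Bigl[\widetilde C^2\Bigl(2-\frac2b\Bigr)^3\Bigr]^{|u|}\,b^{-2|\kappa|/d}\,\|h_u\|_\infty^2,\qquad \widetilde C=d^{1/2}(2^d-1)C^d .$$ -/

import Mathlib

open MeasureTheory Set
open scoped ENNReal NNReal

namespace ScrambledGeometric

noncomputable section

/-- The concatenated space `ℝ^{ds}`: coordinate `(j, i)` is the `i`-th component of the `j`-th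
block `x_j ∈ ℝ^d`. -/
abbrev Pt (s d : ℕ) : Type := Fin s × Fin d → ℝ

/-- The block `x_j ∈ ℝ^d` (with the Euclidean norm) of `x ∈ ℝ^{ds}`. -/
def block {s d : ℕ} (x : Pt s d) (j : Fin s) : EuclideanSpace ℝ (Fin d) :=
  WithLp.toLp 2 (fun i => x (j, i))

/-- The Cartesian product `X^{1:s}` as a subset of `ℝ^{ds}`. -/
def prodSet {s d : ℕ} (X : Fin s → Set (EuclideanSpace ℝ (Fin d))) : Set (Pt s d) :=
  {x | ∀ j, block x j ∈ X j}

/-- A recursive `b`-fold split of `X`. The cells of level `k` are `X_{a_1,…,a_k}`, indexed by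
digit words of length `k`, equivalently by `t ∈ {0, …, b^k - 1}`. -/
structure RecursiveSplit {d : ℕ} (b : ℕ) (X : Set (EuclideanSpace ℝ (Fin d))) where
  cell : (k : ℕ) → (Fin k → Fin b) → Set (EuclideanSpace ℝ (Fin d))
  cell_zero : ∀ w, cell 0 w = X
  measurableSet_cell : ∀ k w, MeasurableSet (cell k w)
  cell_eq_iUnion : ∀ k w, cell k w = ⋃ c : Fin b, cell (k + 1) (Fin.snoc w c)
  volume_child : ∀ k w (c : Fin b), volume (cell (k + 1) (Fin.snoc w c)) = volume (cell k w) / b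
  volume_inter : ∀ k w (c c' : Fin b), c ≠ c' →
    volume (cell (k + 1) (Fin.snoc w c) ∩ cell (k + 1) (Fin.snoc w c')) = 0

/-! ### Partial derivatives and smoothness -/

/-- The hybrid point `x_{-w} : y_w`. -/
def hybrid {ι : Type*} [DecidableEq ι] (w : Finset ι) (x : ι → ℝ) (y : w → ℝ) : ι → ℝ :=
  fun p => if h : p ∈ w then y ⟨p, h⟩ else x p

/-- The partial derivative in the coordinate `p`; it is `0` where it does not exist. -/
def pderiv {ι : Type*} [DecidableEq ι] (p : ι) (g : (ι → ℝ) → ℝ) : (ι → ℝ) → ℝ :=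
  fun x => deriv (fun t => g (Function.update x p t)) (x p)

/-- The mixed partial derivative `∂^v g`, once in each coordinate of `v`. -/
def mixedPartial {s d : ℕ} (v : Finset (Fin s × Fin d)) (g : Pt s d → ℝ) : Pt s d → ℝ :=
  (((List.finRange s).product (List.finRange d)).filter (fun p => p ∈ v)).foldr pderiv g

/-- At the point `x`, the number `g'` is the partial derivative in coordinate `p` of the function
`g` on the set `A` (one-sided at an end of a segment of the coordinate line in `A`). -/
def HasPartialWithin {ι : Type*} [DecidableEq ι] (A : Set (ι → ℝ)) (p : ι)
    (g : (ι → ℝ) → ℝ) (g' : ℝ) (x : ι → ℝ) : Prop :=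
  HasDerivWithinAt (fun t => g (Function.update x p t)) g' {t | Function.update x p t ∈ A} (x p)

/-- `f` is smooth on `A`: its mixed partial derivatives `∂^v f`, at most one derivative in each
coordinate, exist and are continuous on `A`. -/
def SmoothOn {ι : Type*} [DecidableEq ι] (A : Set (ι → ℝ)) (f : (ι → ℝ) → ℝ) : Prop :=
  ∃ D : Finset ι → (ι → ℝ) → ℝ,
    EqOn (D ∅) f A ∧ (∀ v, ContinuousOn (D v) A) ∧
    ∀ v, ∀ p ∉ v, ∀ x ∈ A, HasPartialWithin A p (D v) (D (insert p v) x) x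

/-- `f ∈ C^m(A)`: all partial derivatives of total order at most `m` exist and are continuous
on `A`. -/
def CmOn {ι : Type*} [DecidableEq ι] [Fintype ι] (m : ℕ) (A : Set (ι → ℝ))
    (f : (ι → ℝ) → ℝ) : Prop :=
  ∃ D : (ι → ℕ) → (ι → ℝ) → ℝ,
    EqOn (D 0) f A ∧ (∀ k, ∑ p, k p ≤ m → ContinuousOn (D k) A) ∧
    ∀ k, ∑ p, k p < m → ∀ p, ∀ x ∈ A, HasPartialWithin A p (D k) (D (k + Pi.single p 1) x) x

/-! ### Rectangular hulls and extensions -/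

/-- The rectangular hull (bounding box) of a nonempty bounded set. -/
def rectHull {ι : Type*} (A : Set (ι → ℝ)) : Set (ι → ℝ) :=
  Icc (fun p => sInf ((fun x => x p) '' A)) (fun p => sSup ((fun x => x p) '' A))

/-- `A` is Sobol' extensible with anchor `c`. -/
def IsSobolExtensible {ι : Type*} (A : Set (ι → ℝ)) (c : ι → ℝ) : Prop :=
  IsClosed A ∧ (interior A).Nonempty ∧ c ∈ A ∧
    ∀ z ∈ A, {y : ι → ℝ | ∀ p, y p ∈ uIcc (c p) (z p)} ⊆ A

open Classical in
/-- The Sobol' extension of `g` from `A` with anchor `c`: the sum over `w` of the signed integrals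
over `[c_w, x_w]` of `∂^w g (c_{-w} : y_w)` times the indicator of `c_{-w} : y_w ∈ A`. -/
def sobolExtension {s d : ℕ} (A : Set (Pt s d)) (c : Pt s d) (g : Pt s d → ℝ) : Pt s d → ℝ :=
  fun x => ∑ w : Finset (Fin s × Fin d),
    (-1 : ℝ) ^ (w.filter (fun p => x p < c p)).card *
      ∫ y in (univ.pi fun p : w => uIcc (c p) (x p) : Set (w → ℝ)),
        A.indicator (mixedPartial w g) (hybrid w c y)

/-- `F` is a `C^m` function on the bounding box of `A` that agrees with `g` on `A`. The Whitney
extension of `g` is such a function; its further properties are not required. -/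
def IsCmExtension {ι : Type*} [Fintype ι] (m : ℕ) (A : Set (ι → ℝ))
    (g F : (ι → ℝ) → ℝ) : Prop :=
  ContDiffOn ℝ (m : WithTop ℕ∞) F (rectHull A) ∧ EqOn F g A

/-! ### ANOVA -/

/-- The coordinates of the blocks `j ∈ u`. -/
def coords {s : ℕ} (d : ℕ) (u : Finset (Fin s)) : Finset (Fin s × Fin d) :=
  Finset.univ.filter (fun p => p.1 ∈ u)

/-- The ANOVA component `f_u`, with
`f_u(x) = ∫_{X^{-u}} (f(x) - ∑_{v ⊊ u} f_v(x)) dx_{-u}`. -/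
def anova {s d : ℕ} (X : Fin s → Set (EuclideanSpace ℝ (Fin d))) (f : Pt s d → ℝ)
    (u : Finset (Fin s)) (x : Pt s d) : ℝ :=
  ∫ y in {y : (coords d uᶜ) → ℝ | ∀ j ∉ u, block (hybrid (coords d uᶜ) x y) j ∈ X j},
    (f (hybrid (coords d uᶜ) x y) -
      ∑ v ∈ u.ssubsets.attach, anova X f v.1 (hybrid (coords d uᶜ) x y))
termination_by u.card
decreasing_by exact Finset.card_lt_card (Finset.mem_ssubsets.1 v.2)

/-! ### Multiresolution -/

section Multiresolution

variable {s d b : ℕ} {X : Fin s → Set (EuclideanSpace ℝ (Fin d))}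

/-- The univariate-block basis function
`ψ_{ktc} = b^{(k+1)/2} 1_{X_{(k,t,c)}} - b^{(k-1)/2} 1_{X_{(k,t)}}`. -/
def psiBlock {Y : Set (EuclideanSpace ℝ (Fin d))} (S : RecursiveSplit b Y) (k : ℕ)
    (t : Fin k → Fin b) (c : Fin b) (x : EuclideanSpace ℝ (Fin d)) : ℝ :=
  (b : ℝ) ^ (((k : ℝ) + 1) / 2) * (S.cell (k + 1) (Fin.snoc t c)).indicator 1 x -
    (b : ℝ) ^ (((k : ℝ) - 1) / 2) * (S.cell k t).indicator 1 x

/-- The basis function `ψ_{uκτγ}` on `X^{1:s}`. -/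
def psi (S : ∀ j, RecursiveSplit b (X j)) (u : Finset (Fin s)) (κ : u → ℕ)
    (τ : ∀ j : u, Fin (κ j) → Fin b) (γ : u → Fin b) (x : Pt s d) : ℝ :=
  ∏ j : u, psiBlock (S j) (κ j) (τ j) (γ j) (block x j)

/-- `ν_{uκ} = ∑_τ ∑_γ ⟨f, ψ_{uκτγ}⟩ ψ_{uκτγ}`. -/
def nu (S : ∀ j, RecursiveSplit b (X j)) (f : Pt s d → ℝ) (u : Finset (Fin s)) (κ : u → ℕ)
    (x : Pt s d) : ℝ :=
  ∑ τ : (∀ j : u, Fin (κ j) → Fin b), ∑ γ : u → Fin b,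
    (∫ z in prodSet X, f z * psi S u κ τ γ z) * psi S u κ τ γ x

/-- `σ²_{uκ} = ∫_{X^{1:s}} ν_{uκ}²`. -/
def sigmaSq (S : ∀ j, RecursiveSplit b (X j)) (f : Pt s d → ℝ) (u : Finset (Fin s))
    (κ : u → ℕ) : ℝ :=
  ∫ x in prodSet X, nu S f u κ x ^ 2

/-- The product `B_{uκτ}` of the cells `X_{j,(k_j,t_j)}`, `j ∈ u`, and the `X^{(j)}`, `j ∉ u`. -/
def cellBox (S : ∀ j, RecursiveSplit b (X j)) (u : Finset (Fin s)) (κ : u → ℕ)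
    (τ : ∀ j : u, Fin (κ j) → Fin b) : Set (Pt s d) :=
  {x | (∀ j : u, block x j ∈ (S j).cell (κ j) (τ j)) ∧ ∀ j ∉ u, block x j ∈ X j}

/-- The subsets of `S_u` that meet `S_j` for each `j ∈ u`. -/
def coverSets (d : ℕ) (u : Finset (Fin s)) : Finset (Finset (Fin s × Fin d)) :=
  (coords d u).powerset.filter (fun T => ∀ j ∈ u, ∃ i, (j, i) ∈ T)

/-- `h(z) = max_v |∂^v F(z)|` over the sets `v` of `coverSets d u`. -/
def hMax (u : Finset (Fin s)) (F : Pt s d → ℝ) (z : Pt s d) : ℝ :=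
  (((coverSets d u).sup fun v => ‖mixedPartial v F z‖₊ : ℝ≥0) : ℝ)

/-- The essential supremum of `hMax u F` on the union over `τ` of the bounding boxes of the sets
`B_{uκτ}`. -/
def hNorm (S : ∀ j, RecursiveSplit b (X j)) (u : Finset (Fin s)) (κ : u → ℕ)
    (F : Pt s d → ℝ) : ℝ≥0∞ :=
  eLpNorm (hMax u F) ⊤ (volume.restrict (⋃ τ, rectHull (cellBox S u κ τ)))

end Multiresolution

end

end ScrambledGeometric

namespace ScrambledGeometric

noncomputable section

set_option linter.unusedSectionVars false

section Hybrid

variable {ι : Type*} [DecidableEq ι]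

theorem hybrid_of_mem {w : Finset ι} {p : ι} (h : p ∈ w) (x : ι → ℝ) (y : w → ℝ) :
    hybrid w x y p = y ⟨p, h⟩ := by simp [hybrid, h]

theorem hybrid_of_notMem {w : Finset ι} {p : ι} (h : p ∉ w) (x : ι → ℝ) (y : w → ℝ) :
    hybrid w x y p = x p := by simp [hybrid, h]

theorem hybrid_restrict (w : Finset ι) (x z : ι → ℝ) :
    hybrid w x (fun p => z p) = w.piecewise z x := by
  ext p; by_cases h : p ∈ w <;> simp [hybrid, h]

theorem hybrid_congr {w : Finset ι} {x x' : ι → ℝ} (h : ∀ p ∉ w, x p = x' p) (y : w → ℝ) :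
    hybrid w x y = hybrid w x' y := by
  ext p; by_cases hp : p ∈ w <;> simp [hybrid, hp, h]

theorem hybrid_empty (x : ι → ℝ) (y : (∅ : Finset ι) → ℝ) : hybrid ∅ x y = x := by
  ext p; simp [hybrid]

theorem hybrid_update_of_mem {w : Finset ι} {p : ι} (h : p ∈ w) (x : ι → ℝ) (t : ℝ) (y : w → ℝ) :
    hybrid w (Function.update x p t) y = hybrid w x y :=
  hybrid_congr (fun q hq => by
    rw [Function.update_of_ne]; rintro rfl; exact hq h) y

theorem hybrid_update_of_notMem {w : Finset ι} {p : ι} (h : p ∉ w) (x : ι → ℝ) (t : ℝ)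
    (y : w → ℝ) : hybrid w (Function.update x p t) y = Function.update (hybrid w x y) p t := by
  ext q
  by_cases hq : q = p
  · subst hq; simp [hybrid, h]
  · by_cases hw : q ∈ w <;> simp [hybrid, hw, hq]

theorem measurable_hybrid (w : Finset ι) :
    Measurable fun q : (ι → ℝ) × (w → ℝ) => hybrid w q.1 q.2 := by
  refine measurable_pi_lambda _ fun p => ?_
  by_cases h : p ∈ w
  · simp only [hybrid_of_mem h]
    exact (measurable_pi_apply (⟨p, h⟩ : w)).comp measurable_snd
  · simp only [hybrid_of_notMem h]
    exact (measurable_pi_apply p).comp measurable_fst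

theorem continuous_hybrid (w : Finset ι) :
    Continuous fun q : (ι → ℝ) × (w → ℝ) => hybrid w q.1 q.2 := by
  refine continuous_pi fun p => ?_
  by_cases h : p ∈ w
  · simp only [hybrid_of_mem h]
    exact (continuous_apply (⟨p, h⟩ : w)).comp continuous_snd
  · simp only [hybrid_of_notMem h]
    exact (continuous_apply p).comp continuous_fst

theorem measurable_hybrid_right (w : Finset ι) (x : ι → ℝ) : Measurable (hybrid w x) :=
  (measurable_hybrid w).comp (measurable_const.prodMk measurable_id)

theorem continuous_hybrid_right (w : Finset ι) (x : ι → ℝ) : Continuous (hybrid w x) :=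
  (continuous_hybrid w).comp (continuous_const.prodMk continuous_id)

variable [Fintype ι]

/-- The splitting of `ℝ^ι` into the coordinates in `w` and the others. -/
def splitEquiv (w : Finset ι) : (ι → ℝ) ≃ᵐ (w → ℝ) × ({p // p ∉ w} → ℝ) :=
  MeasurableEquiv.piEquivPiSubtypeProd (fun _ => ℝ) (· ∈ w)

theorem splitEquiv_apply (w : Finset ι) (x : ι → ℝ) :
    splitEquiv w x = (fun p : w => x p, fun p : {p // p ∉ w} => x p) := rfl

theorem splitEquiv_symm_eq_hybrid (w : Finset ι) (y : w → ℝ) (x : ι → ℝ) :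
    (splitEquiv w).symm (y, fun p : {p // p ∉ w} => x p) = hybrid w x y := by
  rw [MeasurableEquiv.symm_apply_eq, splitEquiv_apply]
  ext p
  · simp [hybrid]
  · simp [hybrid, p.2]

theorem measurePreserving_splitEquiv (w : Finset ι) :
    MeasurePreserving (splitEquiv w) volume volume := by
  convert volume_preserving_piEquivPiSubtypeProd (fun _ : ι => ℝ) (· ∈ w) <;> rfl

theorem ae_ae_hybrid {P : (ι → ℝ) → Prop} (h : ∀ᵐ x, P x) (w : Finset ι) :
    ∀ᵐ x : ι → ℝ, ∀ᵐ y : w → ℝ, P (hybrid w x y) := by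
  have h1 : ∀ᵐ q : (w → ℝ) × ({p // p ∉ w} → ℝ), P ((splitEquiv w).symm q) :=
    (measurePreserving_splitEquiv w).symm.quasiMeasurePreserving.ae h
  have h2 : ∀ᵐ q : ({p // p ∉ w} → ℝ) × (w → ℝ), P ((splitEquiv w).symm q.swap) :=
    (Measure.measurePreserving_swap (μ := volume) (ν := volume)).quasiMeasurePreserving.ae h1
  have h3 := Measure.ae_ae_of_ae_prod h2
  have h4 : Measure.QuasiMeasurePreserving (fun x : ι → ℝ => (splitEquiv w x).2) volume volume :=
    Measure.quasiMeasurePreserving_snd.comp (measurePreserving_splitEquiv w).quasiMeasurePreserving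
  filter_upwards [h4.ae h3] with x hx
  filter_upwards [hx] with y hy
  rwa [← splitEquiv_symm_eq_hybrid]

/-- Fubini for functions that split as a product along `w`. -/
theorem integral_split_mul (w : Finset ι) (α : (w → ℝ) → ℝ) (β : ({p // p ∉ w} → ℝ) → ℝ) :
    ∫ x : ι → ℝ, α (fun p : w => x p) * β (fun p : {p // p ∉ w} => x p) = (∫ y, α y) * ∫ z, β z := by
  have := (measurePreserving_splitEquiv w).integral_comp' (fun q => α q.1 * β q.2)
  rwa [Measure.volume_eq_prod, integral_prod_mul] at this

end Hybrid

section SignedIntegral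

variable {ι : Type*} [DecidableEq ι]

/-- Insertion of a coordinate into a vector indexed by a finite set. -/
def insertCoord (p : ι) (w : Finset ι) (q : ℝ × (w → ℝ)) : (↥(insert p w) → ℝ) :=
  fun r => if h : r.1 = p then q.1 else q.2 ⟨r.1, Finset.mem_of_mem_insert_of_ne r.2 h⟩

theorem measurable_insertCoord (p : ι) (w : Finset ι) : Measurable (insertCoord p w) := by
  refine measurable_pi_lambda _ fun r => ?_
  unfold insertCoord
  by_cases h : r.1 = p
  · simp only [h, dite_true]; exact measurable_fst
  · simp only [h, dite_false]; exact (measurable_pi_apply _).comp measurable_snd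

theorem insertCoord_preimage_pi {p : ι} {w : Finset ι} (hp : p ∉ w)
    (s : ↥(insert p w) → Set ℝ) :
    insertCoord p w ⁻¹' univ.pi s =
      s ⟨p, Finset.mem_insert_self p w⟩ ×ˢ
        univ.pi fun r : w => s ⟨r, Finset.mem_insert_of_mem r.2⟩ := by
  ext q
  simp only [mem_preimage, mem_univ_pi, mem_prod, insertCoord]
  constructor
  · intro h
    refine ⟨by simpa using h ⟨p, Finset.mem_insert_self p w⟩, fun r => ?_⟩
    have := h ⟨r, Finset.mem_insert_of_mem r.2⟩
    have hr : r.1 ≠ p := fun h => hp (h ▸ r.2)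
    simpa [hr] using this
  · rintro ⟨h1, h2⟩ ⟨r, hr⟩
    by_cases h : r = p
    · subst h; simpa using h1
    · simpa [h] using h2 ⟨r, Finset.mem_of_mem_insert_of_ne hr h⟩

theorem measurePreserving_insertCoord {p : ι} {w : Finset ι} (hp : p ∉ w) :
    MeasurePreserving (insertCoord p w) volume volume := by
  refine ⟨measurable_insertCoord p w, ?_⟩
  symm
  refine Measure.pi_eq fun s hs => ?_
  rw [Measure.map_apply (measurable_insertCoord p w) (MeasurableSet.univ_pi hs),
    insertCoord_preimage_pi hp, Measure.volume_eq_prod, Measure.prod_prod, volume_pi_pi]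
  rw [← (Finset.subtypeInsertEquivOption hp).symm.prod_comp, Fintype.prod_option]
  rfl

theorem measurableEmbedding_insertCoord {p : ι} {w : Finset ι} (hp : p ∉ w) :
    MeasurableEmbedding (insertCoord p w) := by
  let g : (↥(insert p w) → ℝ) → ℝ × (w → ℝ) := fun y =>
    (y ⟨p, Finset.mem_insert_self p w⟩, fun r => y ⟨r, Finset.mem_insert_of_mem r.2⟩)
  have hg : Measurable g := by fun_prop
  refine (MeasurableEquiv.measurableEmbedding
    { toFun := insertCoord p w, invFun := g, left_inv := ?_, right_inv := ?_
      measurable_toFun := measurable_insertCoord p w, measurable_invFun := hg } )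
  · rintro ⟨t, y⟩
    ext r
    · simp [g, insertCoord]
    · have hr : r.1 ≠ p := fun h => hp (h ▸ r.2)
      simp [g, insertCoord, hr]
  · intro y
    ext ⟨r, hr⟩
    by_cases h : r = p
    · subst h; simp [g, insertCoord]
    · simp [g, insertCoord, h]

theorem hybrid_insertCoord {p : ι} {w : Finset ι} (hp : p ∉ w) (z : ι → ℝ) (t : ℝ)
    (y : w → ℝ) :
    hybrid (insert p w) z (insertCoord p w (t, y)) = hybrid w (Function.update z p t) y := by
  ext q
  by_cases hq : q = p
  · subst hq; simp [hybrid, hp, insertCoord]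
  · by_cases hw : q ∈ w <;> simp [hybrid, hw, hq, insertCoord]

/-- The integral of `G` in the coordinates of `w` over the box spanned by `a` and `x`, with the
sign of the orientation; the other coordinates are those of `z`. -/
def signedIntegral (w : Finset ι) (a x : ι → ℝ) (G : (ι → ℝ) → ℝ) (z : ι → ℝ) : ℝ :=
  (-1 : ℝ) ^ (w.filter (fun p => x p < a p)).card *
    ∫ y in (univ.pi fun p : w => uIcc (a p) (x p) : Set (w → ℝ)), G (hybrid w z y)

theorem measurableSet_spanBox (w : Finset ι) (a x : ι → ℝ) :
    MeasurableSet (univ.pi fun p : w => uIcc (a p) (x p) : Set (w → ℝ)) :=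
  MeasurableSet.univ_pi fun _ => measurableSet_uIcc

theorem volume_spanBox (w : Finset ι) (a x : ι → ℝ) :
    volume (univ.pi fun p : w => uIcc (a p) (x p) : Set (w → ℝ)) =
      ENNReal.ofReal (∏ p ∈ w, |x p - a p|) := by
  rw [volume_pi_pi, ENNReal.ofReal_prod_of_nonneg (fun _ _ => abs_nonneg _),
    ← Finset.prod_coe_sort w fun p => ENNReal.ofReal |x p - a p|]
  simp [uIcc, Real.volume_Icc, max_sub_min_eq_abs]

theorem signedIntegral_empty (a x : ι → ℝ) (G : (ι → ℝ) → ℝ) (z : ι → ℝ) :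
    signedIntegral ∅ a x G z = G z := by
  have : (univ.pi fun p : (∅ : Finset ι) => uIcc (a p) (x p) : Set ((∅ : Finset ι) → ℝ)) = univ := by
    ext y; simp
  simp only [signedIntegral, this, hybrid_empty]
  simp [Measure.real, volume_pi]

theorem signedIntegral_congr {w : Finset ι} {a x x' z z' : ι → ℝ} {G G' : (ι → ℝ) → ℝ}
    (hx : ∀ p ∈ w, x p = x' p)
    (hG : ∀ y ∈ (univ.pi fun p : w => uIcc (a p) (x p) : Set (w → ℝ)),
      G (hybrid w z y) = G' (hybrid w z' y)) :
    signedIntegral w a x G z = signedIntegral w a x' G' z' := by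
  have h1 : w.filter (fun p => x p < a p) = w.filter (fun p => x' p < a p) :=
    Finset.filter_congr fun p hp => by rw [hx p hp]
  have h2 : (univ.pi fun p : w => uIcc (a p) (x p) : Set (w → ℝ)) =
      univ.pi fun p : w => uIcc (a p) (x' p) := by
    congr 1; ext1 p; rw [hx p p.2]
  unfold signedIntegral
  rw [setIntegral_congr_fun (measurableSet_spanBox w a x) hG, h1, h2]

theorem abs_signedIntegral_le {w : Finset ι} {a x z : ι → ℝ} {G : (ι → ℝ) → ℝ} {M : ℝ}
    (h : ∀ᵐ y : w → ℝ, y ∈ (univ.pi fun p : w => uIcc (a p) (x p) : Set (w → ℝ)) →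
      |G (hybrid w z y)| ≤ M) :
    |signedIntegral w a x G z| ≤ M * ∏ p ∈ w, |x p - a p| := by
  unfold signedIntegral
  rw [abs_mul, abs_pow, abs_neg, abs_one, one_pow, one_mul]
  have := norm_setIntegral_le_of_norm_le_const_ae (μ := volume)
    (s := (univ.pi fun p : w => uIcc (a p) (x p) : Set (w → ℝ)))
    (f := fun y => G (hybrid w z y)) (C := M) (by rw [volume_spanBox]; exact ENNReal.ofReal_lt_top)
    (by rw [ae_restrict_iff' (measurableSet_spanBox w a x)]; exact h)
  rwa [Real.norm_eq_abs, Measure.real, volume_spanBox, ENNReal.toReal_ofReal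
    (Finset.prod_nonneg fun _ _ => abs_nonneg _)] at this

theorem measurable_signedIntegral {α : Type*} [MeasurableSpace α] (w : Finset ι) (a : ι → ℝ)
    {G : (ι → ℝ) → ℝ} (hG : Measurable G) {x z : α → ι → ℝ} (hx : Measurable x)
    (hz : Measurable z) : Measurable fun q => signedIntegral w a (x q) G (z q) := by
  unfold signedIntegral
  refine Measurable.mul ?_ ?_
  · simp_rw [← Finset.prod_const, Finset.prod_filter]
    refine Finset.measurable_prod _ fun p _ => Measurable.ite ?_ measurable_const measurable_const
    exact measurableSet_lt ((measurable_pi_apply p).comp hx) measurable_const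
  · have hS : MeasurableSet {r : α × (w → ℝ) |
        r.2 ∈ (univ.pi fun p : w => uIcc (a p) (x r.1 p) : Set (w → ℝ))} := by
      have : {r : α × (w → ℝ) |
          r.2 ∈ (univ.pi fun p : w => uIcc (a p) (x r.1 p) : Set (w → ℝ))} =
          ⋂ p : w, {r | min (a p) (x r.1 p) ≤ r.2 p ∧ r.2 p ≤ max (a p) (x r.1 p)} := by
        ext r; simp only [mem_ofPred_eq, mem_univ_pi, uIcc, mem_Icc, mem_iInter]
      rw [this]
      refine MeasurableSet.iInter fun p => ?_
      have h1 : Measurable fun r : α × (w → ℝ) => x r.1 p :=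
        (measurable_pi_apply p.1).comp (hx.comp measurable_fst)
      have h2 : Measurable fun r : α × (w → ℝ) => r.2 p :=
        (measurable_pi_apply p).comp measurable_snd
      exact (measurableSet_le (measurable_const.min h1) h2).inter
        (measurableSet_le h2 (measurable_const.max h1))
    have hF : Measurable fun r : α × (w → ℝ) => G (hybrid w (z r.1) r.2) :=
      hG.comp ((measurable_hybrid w).comp ((hz.comp measurable_fst).prodMk measurable_snd))
    have h3 : StronglyMeasurable (Function.uncurry fun (q : α) (y : w → ℝ) =>
        (univ.pi fun p : w => uIcc (a p) (x q p) : Set (w → ℝ)).indicator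
          (fun y => G (hybrid w (z q) y)) y) := (hF.indicator hS).stronglyMeasurable
    have h4 := (h3.integral_prod_right (ν := volume)).measurable
    simpa only [integral_indicator (measurableSet_spanBox w a _)] using h4

/-- Fubini for signed integrals. -/
theorem signedIntegral_insert {p : ι} {w : Finset ι} (hp : p ∉ w) (a x z : ι → ℝ)
    {G : (ι → ℝ) → ℝ} {K : ℝ} (hG : Measurable G) (hK : ∀ x, |G x| ≤ K) :
    signedIntegral (insert p w) a x G z =
      ∫ t in (a p)..(x p), signedIntegral w a x G (Function.update z p t) := by
  have hpre : insertCoord p w ⁻¹'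
      (univ.pi fun r : ↥(insert p w) => uIcc (a r) (x r) : Set (↥(insert p w) → ℝ)) =
      uIcc (a p) (x p) ×ˢ (univ.pi fun r : w => uIcc (a r) (x r) : Set (w → ℝ)) :=
    insertCoord_preimage_pi hp _
  have h1 := (measurePreserving_insertCoord hp).setIntegral_preimage_emb
    (measurableEmbedding_insertCoord hp) (fun y => G (hybrid (insert p w) z y))
    (univ.pi fun r : ↥(insert p w) => uIcc (a r) (x r) : Set (↥(insert p w) → ℝ))
  have hint : IntegrableOn (fun q : ℝ × (w → ℝ) => G (hybrid w (Function.update z p q.1) q.2))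
      (uIcc (a p) (x p) ×ˢ (univ.pi fun r : w => uIcc (a r) (x r) : Set (w → ℝ)))
      (volume.prod volume) := by
    refine Measure.integrableOn_of_bounded (M := K) ?_ (Measurable.aestronglyMeasurable ?_)
      (Filter.Eventually.of_forall fun y => hK _)
    · rw [Measure.prod_prod, volume_spanBox]
      refine ENNReal.mul_ne_top ?_ ENNReal.ofReal_ne_top
      simp [uIcc, Real.volume_Icc]
    · refine hG.comp ((measurable_hybrid w).comp (Measurable.prodMk ?_ measurable_snd))
      exact (measurable_update z).comp measurable_fst
  rw [hpre, Measure.volume_eq_prod] at h1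
  have h2 : ∀ q : ℝ × (w → ℝ), G (hybrid (insert p w) z (insertCoord p w q)) =
      G (hybrid w (Function.update z p q.1) q.2) := fun q => by
    rw [← hybrid_insertCoord hp]
  simp_rw [h2] at h1
  rw [setIntegral_prod _ hint] at h1
  unfold signedIntegral
  rw [← h1, intervalIntegral.integral_const_mul, Finset.filter_insert]
  rcases lt_or_ge (x p) (a p) with h | h
  · rw [if_pos h, Finset.card_insert_of_notMem (by simp [hp]), intervalIntegral.integral_of_ge h.le,
      ← integral_Icc_eq_integral_Ioc, uIcc_of_ge h.le, pow_succ]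
    ring
  · rw [if_neg (not_lt.2 h), intervalIntegral.integral_of_le h, ← integral_Icc_eq_integral_Ioc,
      uIcc_of_le h]

end SignedIntegral

section Family

variable {ι : Type*} [DecidableEq ι]

/-- Along segments of coordinate lines in `B`, the function `G (insert p T)` is an integrated
derivative of `G T` in the coordinate `p`. -/
def IsIntegralFamily (B : Set (ι → ℝ)) (G : Finset ι → (ι → ℝ) → ℝ) : Prop :=
  ∀ T, ∀ p ∉ T, ∀ x ∈ B, ∀ s, (∀ t ∈ uIcc s (x p), Function.update x p t ∈ B) →
    G T x - G T (Function.update x p s) =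
      ∫ t in s..(x p), G (insert p T) (Function.update x p t)

theorem IsIntegralFamily.mono {B B' : Set (ι → ℝ)} {G : Finset ι → (ι → ℝ) → ℝ}
    (h : IsIntegralFamily B G) (hB : B' ⊆ B) : IsIntegralFamily B' G :=
  fun T p hp x hx s hs => h T p hp x (hB hx) s fun t ht => hB (hs t ht)

theorem intervalIntegrable_of_bounded {f : ℝ → ℝ} {K : ℝ} (hf : Measurable f)
    (hK : ∀ t, |f t| ≤ K) (a b : ℝ) : IntervalIntegrable f volume a b := by
  rw [intervalIntegrable_iff]
  exact Measure.integrableOn_of_bounded (M := K) (by simp [uIoc])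
    hf.aestronglyMeasurable (Filter.Eventually.of_forall fun t => hK t)

theorem intervalIntegrable_signedIntegral (w : Finset ι) (a x z : ι → ℝ) (p : ι)
    {G : (ι → ℝ) → ℝ} {K : ℝ} (hG : Measurable G) (hK : ∀ x, |G x| ≤ K) (s r : ℝ) :
    IntervalIntegrable (fun t => signedIntegral w a x G (Function.update z p t)) volume s r :=
  intervalIntegrable_of_bounded
    (measurable_signedIntegral w a hG measurable_const (measurable_update z))
    (fun _ => abs_signedIntegral_le (Filter.Eventually.of_forall fun _ _ => hK _)) s r

/-- The expansion of `G v` at the anchor `a`. -/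
theorem IsIntegralFamily.expansion {B : Set (ι → ℝ)} {G : Finset ι → (ι → ℝ) → ℝ}
    (h : IsIntegralFamily B G) (hm : ∀ T, Measurable (G T)) {K : ℝ} (hK : ∀ T x, |G T x| ≤ K)
    {a : ι → ℝ} (hB : ∀ x ∈ B, {y : ι → ℝ | ∀ p, y p ∈ uIcc (a p) (x p)} ⊆ B) (W : Finset ι) :
    ∀ v, Disjoint v W → ∀ x ∈ B,
      G v x = ∑ w ∈ W.powerset, signedIntegral w a x (G (v ∪ w)) (W.piecewise a x) := by
  induction W using Finset.induction_on with
  | empty => intro v _ x _; simp [signedIntegral_empty]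
  | insert p W hpW ih =>
    intro v hv x hx
    rw [Finset.disjoint_insert_right] at hv
    have hseg : ∀ t ∈ uIcc (a p) (x p), Function.update x p t ∈ B := by
      intro t ht
      refine hB x hx fun q => ?_
      by_cases hq : q = p
      · subst hq; simpa using ht
      · simp [hq]
    have hFTC := h v p hv.1 x hx (a p) hseg
    have e1 : W.piecewise a (Function.update x p (a p)) = (insert p W).piecewise a x := by
      ext q
      by_cases hq : q = p
      · subst hq; simp [hpW]
      · by_cases hw : q ∈ W <;> simp [hw, hq]
    have e2 : ∀ t, W.piecewise a (Function.update x p t) =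
        Function.update ((insert p W).piecewise a x) p t := by
      intro t; ext q
      by_cases hq : q = p
      · subst hq; simp [hpW]
      · by_cases hw : q ∈ W <;> simp [hw, hq]
    have e3 : ∀ w ∈ W.powerset, ∀ t, ∀ q ∈ w, Function.update x p t q = x q := by
      intro w hw t q hq
      rw [Function.update_of_ne]
      rintro rfl
      exact hpW (Finset.mem_powerset.1 hw hq)
    have i1 := ih v hv.2 _ (hseg _ left_mem_uIcc)
    have i2 : ∫ t in (a p)..(x p), G (insert p v) (Function.update x p t) =
        ∫ t in (a p)..(x p), ∑ w ∈ W.powerset, signedIntegral w a x (G (insert p v ∪ w))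
          (Function.update ((insert p W).piecewise a x) p t) := by
      refine intervalIntegral.integral_congr fun t ht => ?_
      rw [ih (insert p v) (by simp [hpW, hv.2]) _ (hseg t ht), e2]
      exact Finset.sum_congr rfl fun w hw =>
        signedIntegral_congr (e3 w hw t) fun _ _ => rfl
    rw [intervalIntegral.integral_finsetSum fun w _ =>
      intervalIntegrable_signedIntegral w a x _ p (hm _) (hK _) _ _] at i2
    rw [sub_eq_iff_eq_add] at hFTC
    rw [Finset.sum_powerset_insert hpW, hFTC, i1, i2, add_comm]
    refine congrArg₂ (· + ·) ?_ ?_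
    · refine Finset.sum_congr rfl fun w hw => ?_
      rw [e1]
      exact signedIntegral_congr (e3 w hw _) fun _ _ => rfl
    · refine Finset.sum_congr rfl fun w hw => ?_
      rw [signedIntegral_insert (fun hp => hpW (Finset.mem_powerset.1 hw hp)) a x _ (hm _) (hK _),
        Finset.union_insert, Finset.insert_union]

theorem isIntegralFamily_of_hasPartialWithin {B : Set (ι → ℝ)} {G : Finset ι → (ι → ℝ) → ℝ}
    (hc : ∀ v, ContinuousOn (G v) B)
    (hd : ∀ v, ∀ p ∉ v, ∀ x ∈ B, HasPartialWithin B p (G v) (G (insert p v) x) x) :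
    IsIntegralFamily B G := by
  intro T p hp x hx s hs
  have hcl : ∀ v, ContinuousOn (fun t => G v (Function.update x p t)) (uIcc s (x p)) := fun v =>
    ContinuousOn.comp (t := B) (hc v)
      ((continuous_const.update p continuous_id : Continuous fun t => Function.update x p t)).continuousOn
      hs
  have := intervalIntegral.integral_eq_sub_of_hasDeriv_right (a := s) (b := x p)
    (f := fun t => G T (Function.update x p t))
    (f' := fun t => G (insert p T) (Function.update x p t)) (hcl T) ?_
    (hcl _).intervalIntegrable
  · rw [this]; simp
  · intro t ht
    have h1 := hd T p hp _ (hs t (Ioo_subset_Icc_self ht))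
    unfold HasPartialWithin at h1
    simp only [Function.update_idem, Function.update_self] at h1
    refine (h1.hasDerivAt ?_).hasDerivWithinAt
    exact Filter.mem_of_superset (Ioo_mem_nhds ht.1 ht.2) fun r hr => hs r (Ioo_subset_Icc_self hr)

theorem SmoothOn.exists_family [Fintype ι] {B : Set (ι → ℝ)} {f : (ι → ℝ) → ℝ}
    (h : SmoothOn B f) (hB : IsCompact B) :
    ∃ G : Finset ι → (ι → ℝ) → ℝ, EqOn (G ∅) f B ∧ (∀ T, Measurable (G T)) ∧
      (∃ K, ∀ T x, |G T x| ≤ K) ∧ (∀ T, ContinuousOn (G T) B) ∧ (∀ T, ∀ x ∉ B, G T x = 0) ∧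
      ∀ v, ∀ p ∉ v, ∀ x ∈ B, HasPartialWithin B p (G v) (G (insert p v) x) x := by
  obtain ⟨D, h0, hc, hd⟩ := h
  have hE : ∀ T, EqOn (B.indicator (D T)) (D T) B := fun T x hx => indicator_of_mem hx _
  choose k hk using fun T => hB.exists_bound_of_continuousOn (hc T)
  refine ⟨fun T => B.indicator (D T), (hE ∅).trans h0, fun T => ?_,
    ⟨∑ T, |k T|, fun T x => ?_⟩, fun T => (hc T).congr (hE T),
    fun T x hx => indicator_of_notMem hx _, fun v p hp x hx => ?_⟩
  · classical
    simp only [← piecewise_eq_indicator]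
    exact (hc T).measurable_piecewise continuous_zero.continuousOn hB.measurableSet
  · have h1 : |k T| ≤ ∑ T, |k T| :=
      Finset.single_le_sum (f := fun T => |k T|) (fun _ _ => abs_nonneg _) (Finset.mem_univ T)
    by_cases hx : x ∈ B
    · simp only [hE T hx]; exact (hk T x hx).trans ((le_abs_self _).trans h1)
    · simpa [hx] using (abs_nonneg _).trans h1
  · have := hd v p hp x hx
    unfold HasPartialWithin at this ⊢
    simp only [hE _ hx]
    refine this.congr (fun t ht => hE v ht) ?_
    simpa using hE v hx

end Family

section MixedPartials

variable {ι : Type*} [DecidableEq ι]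

/-- Iterated partial derivatives agree with the derivatives within `A` on a set that is open in
the directions of `w`. -/
theorem foldr_pderiv_eq {A O : Set (ι → ℝ)} {f : (ι → ℝ) → ℝ} {D : Finset ι → (ι → ℝ) → ℝ}
    (h0 : EqOn (D ∅) f A)
    (hd : ∀ v, ∀ p ∉ v, ∀ x ∈ A, HasPartialWithin A p (D v) (D (insert p v) x) x)
    (hOA : O ⊆ A) {w : Finset ι}
    (hO : ∀ x ∈ O, ∀ p ∈ w, ∀ᶠ t in nhds (x p), Function.update x p t ∈ O) :
    ∀ l : List ι, l.Nodup → (∀ p ∈ l, p ∈ w) → ∀ x ∈ O, l.foldr pderiv f x = D l.toFinset x := by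
  intro l
  induction l with
  | nil => intro _ _ x hx; simpa using (h0 (hOA hx)).symm
  | cons p l ih =>
    intro hl hw x hx
    rw [List.nodup_cons] at hl
    have hp : p ∉ l.toFinset := by simpa using hl.1
    have hO' := hO x hx p (hw p (by simp))
    have h1 : (fun t => l.foldr pderiv f (Function.update x p t)) =ᶠ[nhds (x p)]
        fun t => D l.toFinset (Function.update x p t) := by
      filter_upwards [hO'] with t ht
      exact ih hl.2 (fun q hq => hw q (by simp [hq])) _ ht
    have h2 : HasDerivAt (fun t => D l.toFinset (Function.update x p t))
        (D (insert p l.toFinset) x) (x p) :=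
      (hd _ p hp x (hOA hx)).hasDerivAt (hO'.mono fun t ht => hOA ht)
    simp only [List.foldr_cons, pderiv, List.toFinset_cons]
    rw [h1.deriv_eq, h2.deriv]

/-- The coordinates of `v` in the order in which `mixedPartial` differentiates. -/
def coordList {s d : ℕ} (v : Finset (Fin s × Fin d)) : List (Fin s × Fin d) :=
  ((List.finRange s).product (List.finRange d)).filter (fun p => p ∈ v)

theorem mixedPartial_eq_foldr {s d : ℕ} (v : Finset (Fin s × Fin d)) (g : Pt s d → ℝ) :
    mixedPartial v g = (coordList v).foldr pderiv g := rfl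

theorem nodup_coordList {s d : ℕ} (v : Finset (Fin s × Fin d)) : (coordList v).Nodup :=
  ((List.nodup_finRange s).product (List.nodup_finRange d)).filter _

theorem mem_coordList {s d : ℕ} {v : Finset (Fin s × Fin d)} {p : Fin s × Fin d} :
    p ∈ coordList v ↔ p ∈ v := by
  obtain ⟨i, j⟩ := p
  simp [coordList, List.pair_mem_product]

theorem toFinset_coordList {s d : ℕ} (v : Finset (Fin s × Fin d)) :
    (coordList v).toFinset = v := by
  ext p; simp [mem_coordList]

end MixedPartials

section Blocks

variable {K J : Type*} [Fintype K] [Fintype J] {d : ℕ}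

/-- The grouping of the coordinates of a vector into blocks. -/
def blocksEquiv (e : K ≃ J × Fin d) : (K → ℝ) ≃ᵐ (J → Fin d → ℝ) where
  toFun y j i := y (e.symm (j, i))
  invFun g k := g (e k).1 (e k).2
  left_inv y := by ext k; simp
  right_inv g := by ext j i; simp
  measurable_toFun := by
    refine measurable_pi_lambda _ fun j => measurable_pi_lambda _ fun i => measurable_pi_apply _
  measurable_invFun := by
    refine measurable_pi_lambda _ fun k => ?_
    exact (measurable_pi_apply (e k).2).comp (measurable_pi_apply (e k).1)

theorem measurePreserving_blocksEquiv_symm (e : K ≃ J × Fin d) :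
    MeasurePreserving (blocksEquiv e).symm volume volume := by
  refine ⟨(blocksEquiv e).symm.measurable, (Measure.pi_eq fun s hs => ?_).symm⟩
  have hpre : (blocksEquiv e).symm ⁻¹' univ.pi s =
      univ.pi fun j => univ.pi fun i => s (e.symm (j, i)) := by
    ext g
    simp only [mem_preimage, mem_univ_pi]
    constructor
    · intro h j i
      have := h (e.symm (j, i))
      simpa [blocksEquiv] using this
    · intro h k
      have := h (e k).1 (e k).2
      simpa [blocksEquiv] using this
  rw [Measure.map_apply (blocksEquiv e).symm.measurable (MeasurableSet.univ_pi hs), hpre,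
    volume_pi_pi]
  simp_rw [volume_pi_pi]
  rw [← Fintype.prod_prod_type', e.symm.prod_comp fun k => volume (s k)]

theorem measurePreserving_blocks (e : K ≃ J × Fin d) :
    MeasurePreserving (fun (y : K → ℝ) (j : J) =>
      (WithLp.toLp 2 fun i => y (e.symm (j, i)) : EuclideanSpace ℝ (Fin d))) volume volume :=
  (volume_preserving_pi fun _ : J => PiLp.volume_preserving_toLp (Fin d)).comp
    (measurePreserving_blocksEquiv_symm e).symm

theorem measurableEmbedding_blocks (e : K ≃ J × Fin d) :
    MeasurableEmbedding (fun (y : K → ℝ) (j : J) =>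
      (WithLp.toLp 2 fun i => y (e.symm (j, i)) : EuclideanSpace ℝ (Fin d))) :=
  ((blocksEquiv e).trans (MeasurableEquiv.piCongrRight fun _ : J =>
    MeasurableEquiv.toLp 2 (Fin d → ℝ))).measurableEmbedding

theorem integral_prod_blocks (e : K ≃ J × Fin d) (h : J → EuclideanSpace ℝ (Fin d) → ℝ) :
    ∫ y : K → ℝ, ∏ j, h j (WithLp.toLp 2 fun i => y (e.symm (j, i))) = ∏ j, ∫ z, h j z := by
  rw [← integral_fintype_prod_volume_eq_prod,
    ← (measurePreserving_blocks e).integral_comp (measurableEmbedding_blocks e)]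

theorem volume_blocks (e : K ≃ J × Fin d) {X : J → Set (EuclideanSpace ℝ (Fin d))}
    (hX : ∀ j, MeasurableSet (X j)) :
    volume {y : K → ℝ | ∀ j, (WithLp.toLp 2 fun i => y (e.symm (j, i))) ∈ X j} =
      ∏ j, volume (X j) := by
  rw [← volume_pi_pi, ← (measurePreserving_blocks e).measure_preimage
    (MeasurableSet.univ_pi hX).nullMeasurableSet]
  congr 1
  ext y
  simp

end Blocks

section BlockCoordinates

variable {s d : ℕ}

theorem mem_coords {u : Finset (Fin s)} {p : Fin s × Fin d} : p ∈ coords d u ↔ p.1 ∈ u := by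
  simp [coords]

/-- The coordinates of the blocks `j ∈ u` are pairs of a block and a coordinate in it. -/
def coordsEquiv (u : Finset (Fin s)) : ↥(coords d u) ≃ u × Fin d where
  toFun p := (⟨p.1.1, mem_coords.1 p.2⟩, p.1.2)
  invFun q := ⟨(q.1, q.2), mem_coords.2 q.1.2⟩
  left_inv _ := rfl
  right_inv _ := rfl

theorem measurable_block (j : Fin s) : Measurable fun x : Pt s d => block x j :=
  (MeasurableEquiv.toLp 2 (Fin d → ℝ)).measurable.comp
    (measurable_pi_lambda _ fun _ => measurable_pi_apply _)

theorem continuous_block (j : Fin s) : Continuous fun x : Pt s d => block x j :=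
  (PiLp.continuous_toLp 2 _).comp (continuous_pi fun _ => continuous_apply _)

theorem block_congr {x x' : Pt s d} {j : Fin s} (h : ∀ i, x (j, i) = x' (j, i)) :
    block x j = block x' j := by
  unfold block; congr 1; ext i; exact h i

theorem measurePreserving_block : MeasurePreserving (fun (x : Pt s d) j => block x j)
    volume volume := measurePreserving_blocks (Equiv.refl _)

theorem ae_block {P : EuclideanSpace ℝ (Fin d) → Prop} (h : ∀ᵐ z, P z) (j : Fin s) :
    ∀ᵐ x : Pt s d, P (block x j) :=
  ((Measure.quasiMeasurePreserving_eval (fun _ : Fin s => (volume : Measure (EuclideanSpace ℝ (Fin d)))) j).comp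
    measurePreserving_block.quasiMeasurePreserving).ae h

theorem integral_prod_block (h : Fin s → EuclideanSpace ℝ (Fin d) → ℝ) :
    ∫ x : Pt s d, ∏ j, h j (block x j) = ∏ j, ∫ z, h j z :=
  integral_prod_blocks (Equiv.refl _) h

theorem integral_single_block (j : Fin s) (h : EuclideanSpace ℝ (Fin d) → ℝ) (x : Pt s d) :
    ∫ y : ↥(coords d {j}) → ℝ, h (block (hybrid (coords d {j}) x y) j) = ∫ z, h z := by
  have := integral_prod_blocks (coordsEquiv (d := d) {j}) fun _ => h
  simp only [Finset.prod_const, Finset.univ_eq_attach, Finset.card_attach,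
    Finset.card_singleton, pow_one] at this
  rw [← this, ← Finset.univ_eq_attach]
  congr 1; ext y
  rw [Fintype.prod_eq_single (⟨j, by simp⟩ : ({j} : Finset (Fin s)))
    fun i hi => absurd (Subsingleton.elim _ _) hi]
  congr 1
  unfold block; congr 1; ext i
  rw [hybrid_of_mem (by simp [mem_coords])]
  rfl

variable {X : Fin s → Set (EuclideanSpace ℝ (Fin d))}

theorem measurableSet_prodSet (hX : ∀ j, MeasurableSet (X j)) : MeasurableSet (prodSet X) := by
  have : prodSet X = ⋂ j, (fun x => block x j) ⁻¹' X j := by ext; simp [prodSet]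
  rw [this]
  exact MeasurableSet.iInter fun j => measurable_block j (hX j)

theorem volume_prodSet (hX : ∀ j, MeasurableSet (X j)) (h1 : ∀ j, volume (X j) = 1) :
    volume (prodSet X) = 1 := by
  have := volume_blocks (Equiv.refl (Fin s × Fin d)) hX
  simp only [h1, Finset.prod_const_one] at this
  exact this

/-- The slice of the product set in the coordinates of the blocks `j ∈ u`. -/
def sliceSet (X : Fin s → Set (EuclideanSpace ℝ (Fin d))) (u : Finset (Fin s)) (x : Pt s d) :
    Set (↥(coords d u) → ℝ) :=
  {y | ∀ j ∈ u, block (hybrid (coords d u) x y) j ∈ X j}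

theorem block_hybrid_coords {u : Finset (Fin s)} {j : Fin s} (hj : j ∈ u) (x : Pt s d)
    (y : ↥(coords d u) → ℝ) : block (hybrid (coords d u) x y) j =
      WithLp.toLp 2 fun i => y ((coordsEquiv u).symm (⟨j, hj⟩, i)) := by
  unfold block; congr 1; ext i
  rw [hybrid_of_mem (mem_coords.2 hj)]; rfl

theorem block_hybrid_coords_of_notMem {u : Finset (Fin s)} {j : Fin s} (hj : j ∉ u) (x : Pt s d)
    (y : ↥(coords d u) → ℝ) : block (hybrid (coords d u) x y) j = block x j :=
  block_congr fun i => hybrid_of_notMem (by simpa [mem_coords] using hj) _ _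

theorem sliceSet_congr (u : Finset (Fin s)) (x x' : Pt s d) : sliceSet X u x = sliceSet X u x' := by
  ext y
  simp only [sliceSet, mem_ofPred_eq]
  refine forall₂_congr fun j hj => ?_
  rw [block_hybrid_coords hj, block_hybrid_coords hj]

theorem measurableSet_sliceSet (hX : ∀ j, MeasurableSet (X j)) (u : Finset (Fin s)) (x : Pt s d) :
    MeasurableSet (sliceSet X u x) := by
  have : sliceSet X u x =
      ⋂ j ∈ u, (fun y => block (hybrid (coords d u) x y) j) ⁻¹' X j := by ext; simp [sliceSet]
  rw [this]
  exact Finset.measurableSet_biInter _ fun j _ =>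
    ((measurable_block j).comp (measurable_hybrid_right _ x)) (hX j)

theorem volume_sliceSet (hX : ∀ j, MeasurableSet (X j)) (h1 : ∀ j, volume (X j) = 1)
    (u : Finset (Fin s)) (x : Pt s d) : volume (sliceSet X u x) = 1 := by
  have := volume_blocks (coordsEquiv (d := d) u) fun j : u => hX j
  simp only [h1, Finset.prod_const_one] at this
  rw [← this]
  congr 1; ext y
  simp only [sliceSet, mem_ofPred_eq, Subtype.forall]
  refine forall₂_congr fun j hj => ?_
  rw [block_hybrid_coords hj]

theorem hybrid_mem_prodSet_iff {u : Finset (Fin s)} {x : Pt s d} {y : ↥(coords d u) → ℝ} :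
    hybrid (coords d u) x y ∈ prodSet X ↔ (∀ j ∉ u, block x j ∈ X j) ∧ y ∈ sliceSet X u x := by
  simp only [prodSet, sliceSet, mem_ofPred_eq]
  constructor
  · intro h
    exact ⟨fun j hj => by simpa [block_hybrid_coords_of_notMem hj] using h j, fun j _ => h j⟩
  · rintro ⟨h1, h2⟩ j
    by_cases hj : j ∈ u
    · exact h2 j hj
    · rw [block_hybrid_coords_of_notMem hj]; exact h1 j hj

end BlockCoordinates

section Cells

variable {d b : ℕ} {X : Set (EuclideanSpace ℝ (Fin d))}

namespace RecursiveSplit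

variable (S : RecursiveSplit b X)

theorem measurableSet (S : RecursiveSplit b X) : MeasurableSet X :=
  S.cell_zero (fun i => i.elim0) ▸ S.measurableSet_cell 0 _

theorem child_subset {k : ℕ} (t : Fin k → Fin b) (c : Fin b) :
    S.cell (k + 1) (Fin.snoc t c) ⊆ S.cell k t := by
  rw [S.cell_eq_iUnion k t]; exact subset_iUnion (fun c => S.cell (k + 1) (Fin.snoc t c)) c

theorem cell_succ_subset {k : ℕ} (t : Fin (k + 1) → Fin b) :
    S.cell (k + 1) t ⊆ S.cell k (Fin.init t) := by
  conv_lhs => rw [← Fin.snoc_init_self t]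
  exact S.child_subset _ _

theorem cell_subset {k : ℕ} (t : Fin k → Fin b) : S.cell k t ⊆ X := by
  induction k with
  | zero => rw [S.cell_zero]
  | succ k ih => exact (S.cell_succ_subset t).trans (ih _)

theorem exists_mem_cell (k : ℕ) {x : EuclideanSpace ℝ (Fin d)} (hx : x ∈ X) :
    ∃ t, x ∈ S.cell k t := by
  induction k with
  | zero => exact ⟨fun i => i.elim0, by rwa [S.cell_zero]⟩
  | succ k ih =>
    obtain ⟨t, ht⟩ := ih
    rw [S.cell_eq_iUnion, mem_iUnion] at ht
    exact ⟨_, ht.choose_spec⟩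

theorem volume_cell (h1 : volume X = 1) {k : ℕ} (t : Fin k → Fin b) :
    volume (S.cell k t) = ((b : ℝ≥0∞) ^ k)⁻¹ := by
  induction k with
  | zero => simp [S.cell_zero, h1]
  | succ k ih =>
    rw [← Fin.snoc_init_self t, S.volume_child, ih, pow_succ, ENNReal.mul_inv (by simp) (by simp),
      ENNReal.div_eq_inv_mul, mul_comm]

theorem volume_real_cell (h1 : volume X = 1) {k : ℕ} (t : Fin k → Fin b) :
    volume.real (S.cell k t) = ((b : ℝ) ^ k)⁻¹ := by
  simp [Measure.real, S.volume_cell h1]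

theorem volume_inter_cell {k : ℕ} {t t' : Fin k → Fin b} (h : t ≠ t') :
    volume (S.cell k t ∩ S.cell k t') = 0 := by
  induction k with
  | zero => exact absurd (Subsingleton.elim _ _) h
  | succ k ih =>
    by_cases hi : Fin.init t = Fin.init t'
    · have hl : t (Fin.last k) ≠ t' (Fin.last k) := by
        intro hl
        apply h
        rw [← Fin.snoc_init_self t, ← Fin.snoc_init_self t', hi, hl]
      have := S.volume_inter k (Fin.init t) _ _ hl
      rw [Fin.snoc_init_self, hi, Fin.snoc_init_self] at this
      exact this
    · exact measure_mono_null
        (inter_subset_inter (S.cell_succ_subset t) (S.cell_succ_subset t')) (ih hi)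

theorem ae_unique_cell (k : ℕ) :
    ∀ᵐ x, ∀ t t', x ∈ S.cell k t → x ∈ S.cell k t' → t = t' := by
  rw [ae_all_iff]; intro t
  rw [ae_all_iff]; intro t'
  by_cases h : t = t'
  · exact Filter.Eventually.of_forall fun _ _ _ => h
  · have : ∀ᵐ x, x ∉ S.cell k t ∩ S.cell k t' := measure_eq_zero_iff_ae_notMem.1 (S.volume_inter_cell h)
    filter_upwards [this] with x hx h1 h2
    exact absurd ⟨h1, h2⟩ hx

end RecursiveSplit

variable (S : RecursiveSplit b X)

theorem psiBlock_eq (k : ℕ) (t : Fin k → Fin b) (c : Fin b) :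
    psiBlock S k t c = fun x =>
      (S.cell (k + 1) (Fin.snoc t c)).indicator (fun _ => (b : ℝ) ^ (((k : ℝ) + 1) / 2)) x -
        (S.cell k t).indicator (fun _ => (b : ℝ) ^ (((k : ℝ) - 1) / 2)) x := by
  ext x
  classical simp [psiBlock, indicator_apply]

theorem measurable_psiBlock (k : ℕ) (t : Fin k → Fin b) (c : Fin b) :
    Measurable (psiBlock S k t c) := by
  rw [psiBlock_eq]
  exact (measurable_const.indicator (S.measurableSet_cell _ _)).sub
    (measurable_const.indicator (S.measurableSet_cell _ _))

theorem psiBlock_of_notMem {k : ℕ} {t : Fin k → Fin b} {x : EuclideanSpace ℝ (Fin d)}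
    (h : x ∉ S.cell k t) (c : Fin b) : psiBlock S k t c x = 0 := by
  rw [psiBlock, indicator_of_notMem h, indicator_of_notMem fun h' => h (S.child_subset t c h')]
  simp

theorem scale_eq (hb : 2 ≤ b) (k : ℕ) :
    (b : ℝ) ^ (((k : ℝ) + 1) / 2) = b * (b : ℝ) ^ (((k : ℝ) - 1) / 2) := by
  have hb0 : (0 : ℝ) < b := by positivity
  rw [mul_comm, ← Real.rpow_add_one hb0.ne']
  congr 1; ring

theorem scale_mul (hb : 2 ≤ b) (k : ℕ) :
    (b : ℝ) ^ (((k : ℝ) + 1) / 2) * (b : ℝ) ^ (((k : ℝ) - 1) / 2) = (b : ℝ) ^ k := by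
  have hb0 : (0 : ℝ) < b := by positivity
  rw [← Real.rpow_add hb0, ← Real.rpow_natCast]
  congr 1; ring

theorem integrable_cell_indicator (h1 : volume X = 1) (hb : 2 ≤ b) {k : ℕ} (t : Fin k → Fin b)
    (a : ℝ) : Integrable ((S.cell k t).indicator fun _ => a) := by
  rw [integrable_indicator_iff (S.measurableSet_cell _ _)]
  refine integrableOn_const ?_
  rw [S.volume_cell h1]
  simp; omega

theorem integral_cell_indicator (h1 : volume X = 1) {k : ℕ} (t : Fin k → Fin b) (a : ℝ) :
    ∫ x, (S.cell k t).indicator (fun _ => a) x = ((b : ℝ) ^ k)⁻¹ * a := by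
  rw [integral_indicator_const _ (S.measurableSet_cell _ _), S.volume_real_cell h1, smul_eq_mul]

theorem integral_psiBlock (h1 : volume X = 1) (hb : 2 ≤ b) (k : ℕ) (t : Fin k → Fin b)
    (c : Fin b) : ∫ x, psiBlock S k t c x = 0 := by
  have hb0 : (0 : ℝ) < b := by positivity
  rw [psiBlock_eq, integral_sub (integrable_cell_indicator S h1 hb _ _)
    (integrable_cell_indicator S h1 hb _ _), integral_cell_indicator S h1,
    integral_cell_indicator S h1, scale_eq hb, pow_succ]
  field_simp
  ring

theorem integral_abs_psiBlock (h1 : volume X = 1) (hb : 2 ≤ b) (k : ℕ) (t : Fin k → Fin b)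
    (c : Fin b) :
    (b : ℝ) ^ (((k : ℝ) + 1) / 2) * ∫ x, |psiBlock S k t c x| = 2 - 2 / b := by
  have hb0 : (0 : ℝ) < b := by positivity
  have hb1 : (1 : ℝ) ≤ b := by exact_mod_cast (by omega : 1 ≤ b)
  have e : (fun x => |psiBlock S k t c x|) = fun x =>
      (S.cell (k + 1) (Fin.snoc t c)).indicator (fun _ => (b : ℝ) ^ (((k : ℝ) + 1) / 2) -
          2 * (b : ℝ) ^ (((k : ℝ) - 1) / 2)) x +
        (S.cell k t).indicator (fun _ => (b : ℝ) ^ (((k : ℝ) - 1) / 2)) x := by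
    ext x
    have hB : (0 : ℝ) < (b : ℝ) ^ (((k : ℝ) - 1) / 2) := by positivity
    have hA := scale_eq hb k
    rw [psiBlock]
    by_cases hx : x ∈ S.cell (k + 1) (Fin.snoc t c)
    · have hx' := S.child_subset t c hx
      simp only [hx, hx', indicator_of_mem, Pi.one_apply, mul_one]
      rw [abs_of_nonneg (by rw [hA]; nlinarith)]; ring
    · by_cases hx' : x ∈ S.cell k t
      · simp [hx, hx', abs_of_pos hB]
      · simp [hx, hx']
  rw [e, integral_add (integrable_cell_indicator S h1 hb _ _)
    (integrable_cell_indicator S h1 hb _ _), integral_cell_indicator S h1,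
    integral_cell_indicator S h1]
  have hm := scale_mul hb k
  have hA := scale_eq hb k
  generalize (b : ℝ) ^ (((k : ℝ) + 1) / 2) = A at *
  generalize (b : ℝ) ^ (((k : ℝ) - 1) / 2) = B at *
  have : A * (((b : ℝ) ^ (k + 1))⁻¹ * (A - 2 * B) + ((b : ℝ) ^ k)⁻¹ * B) =
      (A * B) * ((b : ℝ) ^ k)⁻¹ * (2 - 2 / b) := by
    rw [hA, pow_succ]; field_simp; ring
  rw [this, hm, mul_inv_cancel₀ (by positivity), one_mul]

theorem ae_sum_psiBlock (hb : 2 ≤ b) (k : ℕ) (t : Fin k → Fin b) :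
    ∀ᵐ x, ∑ c, psiBlock S k t c x = 0 := by
  filter_upwards [S.ae_unique_cell (k + 1)] with x hx
  by_cases hc : x ∈ S.cell k t
  · obtain ⟨c0, h0⟩ : ∃ c, x ∈ S.cell (k + 1) (Fin.snoc t c) := by
      rwa [S.cell_eq_iUnion, mem_iUnion] at hc
    have h2 : ∀ c, (S.cell (k + 1) (Fin.snoc t c)).indicator (1 : EuclideanSpace ℝ (Fin d) → ℝ) x = if c = c0 then 1 else 0 := by
      intro c
      split_ifs with h
      · rw [h]; simp [h0]
      · refine indicator_of_notMem (fun h' => h ?_) _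
        have := congrFun (hx _ _ h' h0) (Fin.last k)
        simpa using this
    simp only [psiBlock, h2, hc, indicator_of_mem, Pi.one_apply, Finset.sum_sub_distrib,
      mul_ite, mul_one, mul_zero, Finset.sum_ite_eq', Finset.mem_univ, if_true, Finset.sum_const,
      Finset.card_univ, Fintype.card_fin, nsmul_eq_mul, scale_eq hb]
    ring
  · exact Finset.sum_eq_zero fun c _ => psiBlock_of_notMem S hc c

/-- Almost every point lies in exactly one cell, so the projection kernel is a multiple of one
basis function. -/
theorem ae_exists_kernel (hb : 2 ≤ b) (k : ℕ) :
    ∀ᵐ x, x ∈ X → ∃ t c, (∀ t', t' ≠ t → ∀ c', psiBlock S k t' c' x = 0) ∧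
      ∀ᵐ z, ∑ c', psiBlock S k t c' z * psiBlock S k t c' x =
        (b : ℝ) ^ (((k : ℝ) + 1) / 2) * psiBlock S k t c z := by
  filter_upwards [S.ae_unique_cell k, S.ae_unique_cell (k + 1)] with x h1 h2 hx
  obtain ⟨t, ht⟩ := S.exists_mem_cell k hx
  obtain ⟨c, hc⟩ : ∃ c, x ∈ S.cell (k + 1) (Fin.snoc t c) := by
    rwa [S.cell_eq_iUnion, mem_iUnion] at ht
  refine ⟨t, c, fun t' h' c' => psiBlock_of_notMem S (fun h => h' (h1 _ _ h ht)) c', ?_⟩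
  filter_upwards [ae_sum_psiBlock S hb k t] with z hz
  have h3 : ∀ c', psiBlock S k t c' x = (if c' = c then (b : ℝ) ^ (((k : ℝ) + 1) / 2) else 0) -
      (b : ℝ) ^ (((k : ℝ) - 1) / 2) := by
    intro c'
    have : (S.cell (k + 1) (Fin.snoc t c')).indicator (1 : EuclideanSpace ℝ (Fin d) → ℝ) x = if c' = c then 1 else 0 := by
      split_ifs with h
      · rw [h]; simp [hc]
      · refine indicator_of_notMem (fun h' => h ?_) _
        have := congrFun (h2 _ _ h' hc) (Fin.last k)
        simpa using this
    simp [psiBlock, this, ht]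
  simp_rw [h3, mul_sub]
  rw [Finset.sum_sub_distrib, ← Finset.sum_mul, hz]
  simp [mul_comm]

end Cells

section RectHull

variable {ι : Type*} {A B : Set (ι → ℝ)}

theorem bddAbove_coord_image (hA : Bornology.IsBounded A) [Fintype ι] (p : ι) :
    BddAbove ((fun x => x p) '' A) ∧ BddBelow ((fun x => x p) '' A) := by
  have h : Bornology.IsBounded ((fun x : ι → ℝ => x p) '' A) :=
    hA.image_eval p
  exact ⟨h.bddAbove, h.bddBelow⟩

theorem subset_rectHull [Fintype ι] (hA : Bornology.IsBounded A) : A ⊆ rectHull A := fun _ hx =>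
  ⟨fun p => csInf_le (bddAbove_coord_image hA p).2 (mem_image_of_mem _ hx),
    fun p => le_csSup (bddAbove_coord_image hA p).1 (mem_image_of_mem _ hx)⟩

theorem rectHull_mono [Fintype ι] (hB : Bornology.IsBounded B) (hA : A.Nonempty) (h : A ⊆ B) :
    rectHull A ⊆ rectHull B := fun _ hx =>
  ⟨fun p => (csInf_le_csInf (bddAbove_coord_image hB p).2 (hA.image _) (image_mono h)).trans
      (hx.1 p),
    fun p => (hx.2 p).trans
      (csSup_le_csSup (bddAbove_coord_image hB p).1 (hA.image _) (image_mono h))⟩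

theorem mem_rectHull_of_mem_uIcc {a x y : ι → ℝ} (ha : a ∈ rectHull A) (hx : x ∈ rectHull A)
    (hy : ∀ p, y p ∈ uIcc (a p) (x p)) : y ∈ rectHull A :=
  ⟨fun p => (le_inf (ha.1 p) (hx.1 p)).trans (hy p).1,
    fun p => (hy p).2.trans (sup_le (ha.2 p) (hx.2 p))⟩

theorem abs_sub_le_of_mem_rectHull {p : ι} {r : ℝ} (hA : A.Nonempty)
    (hr : ∀ x ∈ A, ∀ y ∈ A, |x p - y p| ≤ r) {x a : ι → ℝ} (hx : x ∈ rectHull A)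
    (ha : a ∈ rectHull A) : |x p - a p| ≤ r := by
  have key : sSup ((fun x => x p) '' A) - sInf ((fun x => x p) '' A) ≤ r := by
    rw [sub_le_iff_le_add]
    refine csSup_le (hA.image _) ?_
    rintro _ ⟨y, hy, rfl⟩
    rw [← sub_le_iff_le_add']
    refine le_csInf (hA.image _) ?_
    rintro _ ⟨z, hz, rfl⟩
    have := le_of_abs_le (hr y hy z hz)
    simp only; linarith
  have h1 := hx.1 p; have h2 := hx.2 p; have h3 := ha.1 p; have h4 := ha.2 p
  rw [abs_le]; constructor <;> linarith

end RectHull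

section CellBox

variable {s d b : ℕ} {X : Fin s → Set (EuclideanSpace ℝ (Fin d))}

theorem isBounded_prodSet (hX : ∀ j, Bornology.IsBounded (X j)) :
    Bornology.IsBounded (prodSet X) := by
  choose r hr using fun j => (hX j).exists_norm_le
  refine isBounded_iff_forall_norm_le.2 ⟨∑ j, |r j|, fun x hx => ?_⟩
  refine (pi_norm_le_iff_of_nonneg (Finset.sum_nonneg fun _ _ => abs_nonneg _)).2 fun p => ?_
  calc ‖x p‖ ≤ ‖block x p.1‖ := PiLp.norm_apply_le (block x p.1) p.2
    _ ≤ |r p.1| := (hr p.1 _ (hx p.1)).trans (le_abs_self _)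
    _ ≤ _ := Finset.single_le_sum (f := fun j => |r j|) (fun _ _ => abs_nonneg _)
      (Finset.mem_univ _)

variable (S : ∀ j, RecursiveSplit b (X j)) (u : Finset (Fin s)) (κ : u → ℕ)
  (τ : ∀ j : u, Fin (κ j) → Fin b) (γ : u → Fin b)

theorem cellBox_eq_prodSet : cellBox S u κ τ = prodSet fun j =>
    if h : j ∈ u then (S j).cell (κ ⟨j, h⟩) (τ ⟨j, h⟩) else X j := by
  ext x
  simp only [cellBox, prodSet, mem_ofPred_eq]
  constructor
  · rintro ⟨h1, h2⟩ j
    by_cases h : j ∈ u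
    · simpa [h] using h1 ⟨j, h⟩
    · simpa [h] using h2 j h
  · intro h
    refine ⟨fun j => by simpa using h j, fun j hj => by simpa [hj] using h j⟩

theorem cellBox_subset : cellBox S u κ τ ⊆ prodSet X := by
  rintro x ⟨h1, h2⟩ j
  by_cases h : j ∈ u
  · exact (S j).cell_subset _ (h1 ⟨j, h⟩)
  · exact h2 j h

theorem volume_cellBox_ne_zero (h1 : ∀ j, volume (X j) = 1) : volume (cellBox S u κ τ) ≠ 0 := by
  rw [cellBox_eq_prodSet]
  have := volume_blocks (Equiv.refl (Fin s × Fin d)) (X := fun j =>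
    if h : j ∈ u then (S j).cell (κ ⟨j, h⟩) (τ ⟨j, h⟩) else X j) (fun j => by
      split_ifs
      · exact (S j).measurableSet_cell _ _
      · exact (S j).measurableSet)
  change volume (prodSet _) = _ at this
  rw [this, Finset.prod_ne_zero_iff]
  intro j _
  split_ifs
  · rw [(S j).volume_cell (h1 j)]; simp
  · simp [h1]

theorem cellBox_nonempty (h1 : ∀ j, volume (X j) = 1) : (cellBox S u κ τ).Nonempty :=
  nonempty_of_measure_ne_zero (volume_cellBox_ne_zero S u κ τ h1)

theorem isBounded_cellBox (hX : ∀ j, Bornology.IsBounded (X j)) :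
    Bornology.IsBounded (cellBox S u κ τ) := (isBounded_prodSet hX).subset (cellBox_subset S u κ τ)

theorem measurable_psi : Measurable (psi S u κ τ γ) :=
  Finset.measurable_prod _ fun _ _ => (measurable_psiBlock _ _ _ _).comp (measurable_block _)

theorem exists_bound_psiBlock {Y : Set (EuclideanSpace ℝ (Fin d))} (S : RecursiveSplit b Y) (k : ℕ)
    (t : Fin k → Fin b) (c : Fin b) : ∃ K, ∀ x, |psiBlock S k t c x| ≤ K := by
  refine ⟨|(b : ℝ) ^ (((k : ℝ) + 1) / 2)| + |(b : ℝ) ^ (((k : ℝ) - 1) / 2)|, fun x => ?_⟩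
  rw [psiBlock_eq]
  refine (abs_sub _ _).trans (add_le_add ?_ ?_)
  · exact norm_indicator_le_norm_self (E := ℝ) _ _
  · exact norm_indicator_le_norm_self (E := ℝ) _ _

theorem exists_bound_psi : ∃ K, ∀ x, |psi S u κ τ γ x| ≤ K := by
  choose K hK using fun j : u => exists_bound_psiBlock (S j) (κ j) (τ j) (γ j)
  refine ⟨∏ j, K j, fun x => ?_⟩
  rw [psi, Finset.abs_prod]
  exact Finset.prod_le_prod (fun _ _ => abs_nonneg _) fun j _ => hK j _

theorem mem_cellBox_of_psi_ne_zero {x : Pt s d} (hx : x ∈ prodSet X)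
    (h : psi S u κ τ γ x ≠ 0) : x ∈ cellBox S u κ τ := by
  refine ⟨fun j => ?_, fun _ _ => hx _⟩
  by_contra hj
  exact h (Finset.prod_eq_zero (Finset.mem_univ j) (psiBlock_of_notMem _ hj _))

/-- The basis function is orthogonal to functions that do not depend on one of its blocks. -/
theorem setIntegral_mul_psi_eq_zero (h1 : ∀ j, volume (X j) = 1) (hb : 2 ≤ b) {j : Fin s}
    (hj : j ∈ u) {T : Pt s d → ℝ} (hT : ∀ x x', (∀ p, p.1 ≠ j → x p = x' p) → T x = T x') :
    ∫ x in prodSet X, T x * psi S u κ τ γ x = 0 := by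
  classical
  rw [← integral_indicator (measurableSet_prodSet fun j => (S j).measurableSet)]
  let e : ({p // p ∉ coords d {j}} → ℝ) → Pt s d := fun z p =>
    if h : p ∈ coords d {j} then 0 else z ⟨p, h⟩
  let α : (↥(coords d {j}) → ℝ) → ℝ := fun y =>
    psiBlock (S j) (κ ⟨j, hj⟩) (τ ⟨j, hj⟩) (γ ⟨j, hj⟩) (block (hybrid (coords d {j}) 0 y) j)
  let β : ({p // p ∉ coords d {j}} → ℝ) → ℝ := fun z =>
    T (e z) * ((if ∀ i, i ≠ j → block (e z) i ∈ X i then 1 else 0) *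
      ∏ i ∈ Finset.univ.erase (⟨j, hj⟩ : u), psiBlock (S i) (κ i) (τ i) (γ i) (block (e z) i))
  have he : ∀ (x : Pt s d) p, p.1 ≠ j → e (fun p => x p) p = x p := by
    intro x p hp
    have : p ∉ coords d {j} := by simpa [mem_coords] using hp
    simp [e, this]
  have hbl : ∀ (x : Pt s d) i, i ≠ j → block (e (fun p => x p)) i = block x i := fun x i hi =>
    block_congr fun r => he x _ hi
  have hpt : ∀ x : Pt s d, (prodSet X).indicator (fun x => T x * psi S u κ τ γ x) x =
      α (fun p : coords d {j} => x p) * β (fun p : {p // p ∉ coords d {j}} => x p) := by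
    intro x
    have hα : α (fun p => x p) =
        psiBlock (S j) (κ ⟨j, hj⟩) (τ ⟨j, hj⟩) (γ ⟨j, hj⟩) (block x j) := by
      simp only [α]
      congr 1
      exact block_congr fun i => by rw [hybrid_of_mem (by simp [mem_coords])]
    have hβ : β (fun p => x p) = T x * ((if ∀ i, i ≠ j → block x i ∈ X i then 1 else 0) *
        ∏ i ∈ Finset.univ.erase (⟨j, hj⟩ : u), psiBlock (S i) (κ i) (τ i) (γ i) (block x i)) := by
      simp only [β]
      congr 1
      · exact hT _ _ fun p hp => he x p hp
      · congr 1
        · refine if_congr (forall₂_congr fun i hi => by rw [hbl x i hi]) rfl rfl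
        · refine Finset.prod_congr rfl fun i hi => ?_
          rw [hbl x i fun h => (Finset.ne_of_mem_erase hi) (Subtype.ext h)]
    rw [hα, hβ]
    have hpsi : psi S u κ τ γ x =
        psiBlock (S j) (κ ⟨j, hj⟩) (τ ⟨j, hj⟩) (γ ⟨j, hj⟩) (block x j) *
        ∏ i ∈ Finset.univ.erase (⟨j, hj⟩ : u), psiBlock (S i) (κ i) (τ i) (γ i) (block x i) :=
      (Finset.mul_prod_erase Finset.univ
        (fun i : u => psiBlock (S i) (κ i) (τ i) (γ i) (block x i)) (Finset.mem_univ _)).symm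
    by_cases hx : block x j ∈ X j
    · by_cases hx' : ∀ i, i ≠ j → block x i ∈ X i
      · have : x ∈ prodSet X := fun i => by
          by_cases hi : i = j
          · exact hi ▸ hx
          · exact hx' i hi
        rw [indicator_of_mem this, if_pos hx', hpsi]; ring
      · have : x ∉ prodSet X := fun h => hx' fun i _ => h i
        rw [indicator_of_notMem this, if_neg hx']; ring
    · have : x ∉ prodSet X := fun h => hx (h j)
      rw [indicator_of_notMem this, psiBlock_of_notMem _ fun h => hx ((S j).cell_subset _ h)]; ring
  simp_rw [hpt]
  rw [integral_split_mul (coords d {j}) α β]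
  simp only [α]
  rw [integral_single_block, integral_psiBlock _ (h1 j) hb, zero_mul]

theorem prod_eq_prod_mul_prod_compl {J : Type*} [Fintype J] [DecidableEq J] (u : Finset J)
    (f : J → ℝ) : ∏ i, f i = (∏ i : u, f i) * ∏ i : {i // i ∉ u}, f i := by
  rw [← Fintype.prod_subtype_mul_prod_subtype (· ∈ u)]
  congr!

theorem setIntegral_abs_psi (h1 : ∀ j, volume (X j) = 1) (hb : 2 ≤ b) :
    (∏ j : u, (b : ℝ) ^ (((κ j : ℝ) + 1) / 2)) * ∫ x in prodSet X, |psi S u κ τ γ x| =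
      (2 - 2 / b) ^ u.card := by
  let h : Fin s → EuclideanSpace ℝ (Fin d) → ℝ := fun j z =>
    if hj : j ∈ u then |psiBlock (S j) (κ ⟨j, hj⟩) (τ ⟨j, hj⟩) (γ ⟨j, hj⟩) z|
    else (X j).indicator 1 z
  have hpt : ∀ x : Pt s d, (prodSet X).indicator (fun x => |psi S u κ τ γ x|) x =
      ∏ j, h j (block x j) := by
    intro x
    by_cases hx : x ∈ prodSet X
    · rw [indicator_of_mem hx, prod_eq_prod_mul_prod_compl u, psi,
        Finset.abs_prod]
      have e2 : ∏ i : {x // x ∉ u}, h i (block x i) = 1 :=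
        Finset.prod_eq_one fun i _ => by simp [h, i.2, hx i.1]
      rw [e2, mul_one]
      exact Fintype.prod_congr _ _ fun i => by simp [h]
    · rw [indicator_of_notMem hx]
      simp only [prodSet, mem_ofPred_eq, not_forall] at hx
      obtain ⟨j, hj⟩ := hx
      symm
      refine Finset.prod_eq_zero (Finset.mem_univ j) ?_
      by_cases hu : j ∈ u
      · simp [h, hu, psiBlock_of_notMem _ fun h' => hj ((S j).cell_subset _ h')]
      · simp [h, hu, hj]
  rw [← integral_indicator (measurableSet_prodSet fun j => (S j).measurableSet)]
  simp_rw [hpt]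
  rw [integral_prod_block, prod_eq_prod_mul_prod_compl u]
  have e2 : ∏ i : {x // x ∉ u}, ∫ z, h i z = 1 := by
    refine Finset.prod_eq_one fun i _ => ?_
    simp only [h, i.2, dite_false]
    rw [integral_indicator_one (S i).measurableSet]
    simp [Measure.real, h1]
  rw [e2, mul_one]
  have e3 : (∏ j : u, (b : ℝ) ^ (((κ j : ℝ) + 1) / 2)) * ∏ j : u, ∫ z, h j z =
      ∏ j : u, (2 - 2 / (b : ℝ)) := by
    rw [← Finset.prod_mul_distrib]
    refine Finset.prod_congr rfl fun j _ => ?_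
    simp only [h, j.2, dite_true]
    exact integral_abs_psiBlock _ (h1 j) hb _ _ _
  rw [e3]
  simp

end CellBox

section CoverSets

variable {s : ℕ}

theorem mem_coverSets {d : ℕ} {u : Finset (Fin s)} {T : Finset (Fin s × Fin d)} :
    T ∈ coverSets d u ↔ T ⊆ coords d u ∧ ∀ j ∈ u, ∃ i, (j, i) ∈ T := by
  simp [coverSets]

theorem card_coverSets_le (d : ℕ) (u : Finset (Fin s)) :
    ((coverSets d u).card : ℝ) ≤ (2 ^ d - 1) ^ u.card := by
  have h : (coverSets d u).card ≤
      (Fintype.piFinset fun _ : u => (Finset.univ : Finset (Finset (Fin d))).erase ∅).card := by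
    refine Finset.card_le_card_of_injOn
      (fun T (j : u) => Finset.univ.filter fun i => (j.1, i) ∈ T) ?_ ?_
    · intro T hT
      simp only [Finset.mem_coe, Fintype.mem_piFinset, Finset.mem_erase, Finset.mem_univ, and_true]
      intro j
      obtain ⟨i, hi⟩ := (mem_coverSets.1 hT).2 j j.2
      exact Finset.ne_empty_of_mem (a := i) (by simpa using hi)
    · intro T hT T' hT' he
      ext ⟨j, i⟩
      have h1 := (mem_coverSets.1 hT).1
      have h2 := (mem_coverSets.1 hT').1
      by_cases hj : j ∈ u
      · have := congrFun he ⟨j, hj⟩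
        simpa using congrArg (i ∈ ·) this
      · constructor
        · intro h; exact absurd (mem_coords.1 (h1 h)) hj
        · intro h; exact absurd (mem_coords.1 (h2 h)) hj
  rw [Fintype.card_piFinset] at h
  simp only [Finset.mem_univ, Finset.card_erase_of_mem, Finset.card_univ, Fintype.card_finset,
    Fintype.card_fin, Finset.prod_const] at h
  have h2 : (((2 ^ d - 1) ^ Fintype.card u : ℕ) : ℝ) = (2 ^ d - 1) ^ u.card := by
    rw [Nat.cast_pow, Nat.cast_sub Nat.one_le_two_pow]; simp
  rw [← h2]
  exact_mod_cast h

theorem sum_coverSets_prod_le {d : ℕ} (u : Finset (Fin s)) {r ρ : Fin s → ℝ} (hr : ∀ j, 0 ≤ r j)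
    (hρ : ∀ j ∈ u, ∀ m, 1 ≤ m → m ≤ d → r j ^ m ≤ ρ j) (hρ0 : ∀ j, 0 ≤ ρ j) :
    ∑ T ∈ coverSets d u, ∏ p ∈ T, r p.1 ≤ (2 ^ d - 1) ^ u.card * ∏ j ∈ u, ρ j := by
  have h : ∀ T ∈ coverSets d u, ∏ p ∈ T, r p.1 ≤ ∏ j ∈ u, ρ j := by
    intro T hT
    obtain ⟨h1, h2⟩ := mem_coverSets.1 hT
    rw [← Finset.prod_fiberwise_of_maps_to (t := u) (g := Prod.fst)
      fun p hp => mem_coords.1 (h1 hp)]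
    refine Finset.prod_le_prod (fun j _ => Finset.prod_nonneg fun p _ => hr _) fun j hj => ?_
    rw [Finset.prod_congr rfl fun p hp => by rw [(Finset.mem_filter.1 hp).2], Finset.prod_const]
    refine hρ j hj _ ?_ ?_
    · obtain ⟨i, hi⟩ := h2 j hj
      exact Finset.card_pos.2 ⟨(j, i), by simp [hi]⟩
    · have : (T.filter fun p => p.1 = j).card ≤ (Finset.univ : Finset (Fin d)).card := by
        refine Finset.card_le_card_of_injOn Prod.snd (fun _ _ => Finset.mem_coe.2 (Finset.mem_univ _)) ?_
        intro p hp q hq h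
        simp only [Finset.coe_filter, mem_ofPred_eq] at hp hq
        exact Prod.ext (hp.2.trans hq.2.symm) h
      simpa using this
  calc ∑ T ∈ coverSets d u, ∏ p ∈ T, r p.1 ≤ ∑ T ∈ coverSets d u, ∏ j ∈ u, ρ j :=
        Finset.sum_le_sum h
    _ = (coverSets d u).card * ∏ j ∈ u, ρ j := by rw [Finset.sum_const, nsmul_eq_mul]
    _ ≤ _ := mul_le_mul_of_nonneg_right (card_coverSets_le d u)
      (Finset.prod_nonneg fun j _ => hρ0 j)

end CoverSets

theorem ae_restrict_coords {ι : Type*} [DecidableEq ι] [Fintype ι] {w : Finset ι}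
    {P : (w → ℝ) → Prop} (h : ∀ᵐ y, P y) : ∀ᵐ x : ι → ℝ, P fun p => x p := by
  have : Measure.QuasiMeasurePreserving (fun x : ι → ℝ => (splitEquiv w x).1) volume volume :=
    Measure.quasiMeasurePreserving_fst.comp (measurePreserving_splitEquiv w).quasiMeasurePreserving
  exact this.ae h

section Core

variable {s d b : ℕ} {X : Fin s → Set (EuclideanSpace ℝ (Fin d))}
  (S : ∀ j, RecursiveSplit b (X j)) (u : Finset (Fin s)) (κ : u → ℕ)

/-- Almost every anchor in the box is such that the bounds on `G` hold on almost every slice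
through it. -/
theorem exists_generic_anchor {ι : Type*} [DecidableEq ι] [Fintype ι] {R : Set (ι → ℝ)}
    (hR : volume R ≠ 0) (W : Finset ι) {P : (ι → ℝ) → Prop} (hP : ∀ᵐ x, P x) :
    ∃ a ∈ R, ∀ᵐ x : ι → ℝ, ∀ w : Finset ι, ∀ᵐ y : w → ℝ, P (hybrid w (W.piecewise a x) y) := by
  have h1 : ∀ᵐ x : ι → ℝ, ∀ w : Finset ι, ∀ᵐ y : w → ℝ, P (hybrid w x y) :=
    ae_all_iff.2 fun w => ae_ae_hybrid hP w
  have h2 := ae_ae_hybrid h1 Wᶜ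
  obtain ⟨a, haR, ha⟩ : ∃ a ∈ R, ∀ᵐ y : ↥Wᶜ → ℝ, ∀ w : Finset ι, ∀ᵐ z : w → ℝ,
      P (hybrid w (hybrid Wᶜ a y) z) := by
    by_contra hcon
    push Not at hcon
    exact hR (measure_mono_null (fun a ha => by simpa using hcon a ha) h2)
  refine ⟨a, haR, ?_⟩
  filter_upwards [ae_restrict_coords ha] with x hx
  have : hybrid Wᶜ a (fun p => x p) = W.piecewise a x := by
    rw [hybrid_restrict]; ext p; by_cases hp : p ∈ W <;> simp [hp]
  rwa [this] at hx

theorem abs_inner_psi_le (hb : 2 ≤ b) (hX : ∀ j, Bornology.IsBounded (X j))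
    (h1 : ∀ j, volume (X j) = 1) (τ : ∀ j : u, Fin (κ j) → Fin b) (γ : u → Fin b)
    {G : Finset (Fin s × Fin d) → Pt s d → ℝ} (hm : ∀ T, Measurable (G T)) {K : ℝ}
    (hK : ∀ T x, |G T x| ≤ K) (hG : IsIntegralFamily (rectHull (cellBox S u κ τ)) G) {M : ℝ}
    (hM0 : 0 ≤ M) (hM : ∀ᵐ x, ∀ T ∈ coverSets d u, x ∈ rectHull (cellBox S u κ τ) → |G T x| ≤ M)
    {r : Fin s → ℝ} (hr : ∀ x ∈ rectHull (cellBox S u κ τ), ∀ a ∈ rectHull (cellBox S u κ τ),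
      ∀ p : Fin s × Fin d, p.1 ∈ u → |x p - a p| ≤ r p.1) :
    |∫ x in prodSet X, G ∅ x * psi S u κ τ γ x| ≤
      M * (∑ T ∈ coverSets d u, ∏ p ∈ T, r p.1) * ∫ x in prodSet X, |psi S u κ τ γ x| := by
  have hmeas := measurableSet_prodSet fun j => (S j).measurableSet
  have hvol := volume_prodSet (fun j => (S j).measurableSet) h1
  have hsub := subset_rectHull (isBounded_cellBox S u κ τ hX)
  have hR : volume (rectHull (cellBox S u κ τ)) ≠ 0 := fun h =>
    volume_cellBox_ne_zero S u κ τ h1 (measure_mono_null hsub h)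
  obtain ⟨a, haR, ha⟩ := exists_generic_anchor hR (coords d u) hM
  set R := rectHull (cellBox S u κ τ) with hRdef
  set I : Finset (Fin s × Fin d) → Pt s d → ℝ := fun w x =>
    signedIntegral w a x (G w) ((coords d u).piecewise a x) with hI
  obtain ⟨Kψ, hKψ⟩ := exists_bound_psi S u κ τ γ
  have hexp : ∀ x ∈ prodSet X, G ∅ x * psi S u κ τ γ x =
      ∑ w ∈ (coords d u).powerset, I w x * psi S u κ τ γ x := by
    intro x hx
    by_cases h : psi S u κ τ γ x = 0
    · simp [h]
    · have hxR : x ∈ R := hsub (mem_cellBox_of_psi_ne_zero S u κ τ γ hx h)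
      rw [← Finset.sum_mul, hG.expansion hm hK
        (fun z hz y hy => mem_rectHull_of_mem_uIcc haR hz hy) (coords d u) ∅ (by simp) x hxR]
      simp [hI]
  have hprod : ∀ w ⊆ coords d u, ∀ x ∈ R, ∏ p ∈ w, |x p - a p| ≤ ∏ p ∈ w, r p.1 :=
    fun w hw x hx => Finset.prod_le_prod (fun _ _ => abs_nonneg _) fun p hp =>
      hr x hx a haR p (mem_coords.1 (hw hp))
  have hImeas : ∀ w, Measurable (I w) := fun w => by
    refine measurable_signedIntegral w a (hm w) measurable_id (measurable_pi_lambda _ fun p => ?_)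
    by_cases hp : p ∈ coords d u
    · simp only [hp, Finset.piecewise_eq_of_mem]; exact measurable_const
    · simp only [hp, not_false_eq_true, Finset.piecewise_eq_of_notMem]; exact measurable_pi_apply p
  have hK0 : 0 ≤ K := (abs_nonneg _).trans (hK ∅ a)
  have hKψ0 : 0 ≤ Kψ := (abs_nonneg _).trans (hKψ a)
  have hint : ∀ w ∈ (coords d u).powerset,
      IntegrableOn (fun x => I w x * psi S u κ τ γ x) (prodSet X) := by
    intro w hw
    refine Measure.integrableOn_of_bounded (M := K * (∏ p ∈ w, r p.1) * Kψ) (by simp [hvol])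
      ((hImeas w).mul (measurable_psi S u κ τ γ)).aestronglyMeasurable ?_
    rw [ae_restrict_iff' hmeas]
    refine Filter.Eventually.of_forall fun x hx => ?_
    have hnn : 0 ≤ ∏ p ∈ w, r p.1 := (Finset.prod_nonneg fun _ _ => abs_nonneg _).trans
      (hprod w (Finset.mem_powerset.1 hw) a haR)
    by_cases h : psi S u κ τ γ x = 0
    · simp only [h, mul_zero, norm_zero]; positivity
    · have hxR : x ∈ R := hsub (mem_cellBox_of_psi_ne_zero S u κ τ γ hx h)
      rw [norm_mul]
      refine mul_le_mul ?_ (hKψ x) (norm_nonneg _) (by positivity)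
      exact (abs_signedIntegral_le (Filter.Eventually.of_forall fun _ _ => hK _ _)).trans
        (mul_le_mul_of_nonneg_left (hprod w (Finset.mem_powerset.1 hw) x hxR) hK0)
  have hzero : ∀ w ∈ (coords d u).powerset, w ∉ coverSets d u →
      ∫ x in prodSet X, I w x * psi S u κ τ γ x = 0 := by
    intro w hw hwc
    rw [mem_coverSets] at hwc
    push Not at hwc
    obtain ⟨j, hj, hjw⟩ := hwc (Finset.mem_powerset.1 hw)
    refine setIntegral_mul_psi_eq_zero S u κ τ γ h1 hb hj fun x x' hxx => ?_
    refine signedIntegral_congr (fun p hp => hxx p ?_) fun y _ => ?_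
    · rintro rfl; exact hjw p.2 hp
    · congr 2
      ext p
      by_cases hp : p ∈ coords d u
      · simp [hp]
      · simp only [hp, not_false_eq_true, Finset.piecewise_eq_of_notMem]
        refine hxx p ?_
        rintro rfl
        exact hp (mem_coords.2 hj)
  have hbound : ∀ w ∈ coverSets d u, |∫ x in prodSet X, I w x * psi S u κ τ γ x| ≤
      M * (∏ p ∈ w, r p.1) * ∫ x in prodSet X, |psi S u κ τ γ x| := by
    intro w hw
    rw [← integral_const_mul, ← Real.norm_eq_abs]
    have hw' := (mem_coverSets.1 hw).1
    have hnn : 0 ≤ ∏ p ∈ w, r p.1 := (Finset.prod_nonneg fun _ _ => abs_nonneg _).trans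
      (hprod w hw' a haR)
    have hψint : IntegrableOn (fun x => |psi S u κ τ γ x|) (prodSet X) :=
      Measure.integrableOn_of_bounded (M := Kψ) (by simp [hvol])
        (measurable_psi S u κ τ γ).abs.aestronglyMeasurable
        (Filter.Eventually.of_forall fun x => by simpa using hKψ x)
    refine norm_integral_le_of_norm_le (hψint.const_mul _) ?_
    rw [ae_restrict_iff' hmeas]
    filter_upwards [ha] with x hx hxX
    by_cases h : psi S u κ τ γ x = 0
    · simp [h]
    · have hxR : x ∈ R := hsub (mem_cellBox_of_psi_ne_zero S u κ τ γ hxX h)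
      rw [norm_mul]
      refine mul_le_mul_of_nonneg_right ?_ (norm_nonneg _)
      refine (abs_signedIntegral_le (M := M) ?_).trans
        (mul_le_mul_of_nonneg_left (hprod w hw' x hxR) hM0)
      filter_upwards [hx w] with y hy hyB
      refine hy w hw (mem_rectHull_of_mem_uIcc haR hxR fun p => ?_)
      by_cases hp : p ∈ w
      · rw [hybrid_of_mem hp]; exact hyB ⟨p, hp⟩ (mem_univ _)
      · rw [hybrid_of_notMem hp]
        by_cases hp' : p ∈ coords d u <;> simp [hp']
  rw [setIntegral_congr_fun hmeas hexp, integral_finsetSum _ hint,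
    ← Finset.sum_subset (s₁ := coverSets d u)
      (fun w hw => Finset.mem_powerset.2 (mem_coverSets.1 hw).1) hzero,
    Finset.mul_sum, Finset.sum_mul]
  exact (Finset.abs_sum_le_sum_abs _ _).trans (Finset.sum_le_sum hbound)

/-- Almost everywhere, `ν` is a multiple of the coefficient of one basis function. -/
theorem ae_nu_eq (hb : 2 ≤ b) (h1 : ∀ j, volume (X j) = 1) {f g : Pt s d → ℝ}
    (hfg : ∀ τ γ, ∫ x in prodSet X, f x * psi S u κ τ γ x =
      ∫ x in prodSet X, g x * psi S u κ τ γ x)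
    (hg : Measurable g) {K : ℝ} (hK : ∀ x, |g x| ≤ K) :
    ∀ᵐ x, x ∈ prodSet X → ∃ τ γ, nu S f u κ x =
      (∏ j : u, (b : ℝ) ^ (((κ j : ℝ) + 1) / 2)) * ∫ z in prodSet X, g z * psi S u κ τ γ z := by
  have hvol := volume_prodSet (fun j => (S j).measurableSet) h1
  have hk : ∀ᵐ x : Pt s d, ∀ j : u, block x j ∈ X j → ∃ t c,
      (∀ t', t' ≠ t → ∀ c', psiBlock (S j) (κ j) t' c' (block x j) = 0) ∧
      ∀ᵐ z, ∑ c', psiBlock (S j) (κ j) t c' z * psiBlock (S j) (κ j) t c' (block x j) =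
        (b : ℝ) ^ (((κ j : ℝ) + 1) / 2) * psiBlock (S j) (κ j) t c z :=
    ae_all_iff.2 fun j => ae_block (ae_exists_kernel (S j) hb (κ j)) j.1
  filter_upwards [hk] with x hx hxX
  choose τ γ hτ hγ using fun j : u => hx j (hxX j)
  refine ⟨τ, γ, ?_⟩
  have hz : ∀ τ' ≠ τ, ∀ γ', psi S u κ τ' γ' x = 0 := by
    intro τ' h γ'
    obtain ⟨j, hj⟩ := Function.ne_iff.1 h
    exact Finset.prod_eq_zero (Finset.mem_univ j) (hτ j _ hj _)
  have hint : ∀ γ', IntegrableOn (fun z => g z * psi S u κ τ γ' z) (prodSet X) := by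
    intro γ'
    obtain ⟨Kψ, hKψ⟩ := exists_bound_psi S u κ τ γ'
    refine Measure.integrableOn_of_bounded (M := K * Kψ) (by simp [hvol])
      (hg.mul (measurable_psi S u κ τ γ')).aestronglyMeasurable
      (Filter.Eventually.of_forall fun z => ?_)
    rw [norm_mul]
    exact mul_le_mul (hK z) (hKψ z) (norm_nonneg _) ((abs_nonneg _).trans (hK z))
  have e1 : nu S f u κ x = ∑ γ' : u → Fin b,
      (∫ z in prodSet X, g z * psi S u κ τ γ' z) * psi S u κ τ γ' x := by
    unfold nu
    rw [Finset.sum_eq_single τ (fun τ' _ h => Finset.sum_eq_zero fun γ' _ => by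
      rw [hz τ' h, mul_zero]) (by simp)]
    exact Finset.sum_congr rfl fun γ' _ => by rw [hfg]
  rw [e1]
  simp_rw [← integral_mul_const]
  rw [← integral_finsetSum _ fun γ' _ => (hint γ').mul_const _, ← integral_const_mul]
  refine integral_congr_ae (ae_restrict_of_ae ?_)
  have hz' : ∀ᵐ z : Pt s d, ∀ j : u,
      ∑ c', psiBlock (S j) (κ j) (τ j) c' (block z j) *
        psiBlock (S j) (κ j) (τ j) c' (block x j) =
        (b : ℝ) ^ (((κ j : ℝ) + 1) / 2) * psiBlock (S j) (κ j) (τ j) (γ j) (block z j) :=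
    ae_all_iff.2 fun j => ae_block (hγ j) j.1
  filter_upwards [hz'] with z hz
  have e2 : ∑ γ' : u → Fin b, psi S u κ τ γ' z * psi S u κ τ γ' x =
      ∏ j : u, ∑ c', psiBlock (S j) (κ j) (τ j) c' (block z j) *
        psiBlock (S j) (κ j) (τ j) c' (block x j) := by
    rw [Finset.prod_univ_sum, Fintype.piFinset_univ]
    simp only [psi, Finset.prod_mul_distrib]
  calc ∑ γ' : u → Fin b, g z * psi S u κ τ γ' z * psi S u κ τ γ' x
      = g z * ∑ γ' : u → Fin b, psi S u κ τ γ' z * psi S u κ τ γ' x := by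
        rw [Finset.mul_sum]; simp_rw [mul_assoc]
    _ = _ := by
        rw [e2, Finset.prod_congr rfl fun j _ => hz j, Finset.prod_mul_distrib]
        simp only [psi]; ring

theorem abs_sub_le_of_diam {C : ℝ} (hX : ∀ j, Bornology.IsBounded (X j))
    (h1 : ∀ j, volume (X j) = 1)
    (hdiam : ∀ j k (t : Fin k → Fin b),
      Metric.diam ((S j).cell k t) ≤ C * (b : ℝ) ^ (-(k : ℝ) / (d : ℝ)))
    (τ : ∀ j : u, Fin (κ j) → Fin b) {x a : Pt s d} (hx : x ∈ rectHull (cellBox S u κ τ))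
    (ha : a ∈ rectHull (cellBox S u κ τ)) {p : Fin s × Fin d} (hp : p.1 ∈ u) :
    |x p - a p| ≤ C * (b : ℝ) ^ (-(κ ⟨p.1, hp⟩ : ℝ) / (d : ℝ)) := by
  refine abs_sub_le_of_mem_rectHull (cellBox_nonempty S u κ τ h1) (fun y hy z hz => ?_) hx ha
  calc |y p - z p| = ‖(block y p.1 - block z p.1) p.2‖ := rfl
    _ ≤ ‖block y p.1 - block z p.1‖ := PiLp.norm_apply_le _ _
    _ = dist (block y p.1) (block z p.1) := (dist_eq_norm _ _).symm
    _ ≤ Metric.diam ((S p.1).cell _ (τ ⟨p.1, hp⟩)) := Metric.dist_le_diam_of_mem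
        ((hX p.1).subset ((S p.1).cell_subset _)) (hy.1 ⟨p.1, hp⟩) (hz.1 ⟨p.1, hp⟩)
    _ ≤ _ := hdiam _ _ _

end Core

section Bound

variable {s d b : ℕ} {X : Fin s → Set (EuclideanSpace ℝ (Fin d))}
  (S : ∀ j, RecursiveSplit b (X j)) (u : Finset (Fin s)) (κ : u → ℕ)

theorem measurableSet_rectHull {ι : Type*} [Countable ι] (A : Set (ι → ℝ)) :
    MeasurableSet (rectHull A) :=
  measurableSet_Icc

/-- The mixed partial derivatives are almost everywhere bounded by the essential supremum. -/
theorem ae_abs_mixedPartial_le {F : Pt s d → ℝ} (hN : hNorm S u κ F ≠ ⊤) :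
    ∀ᵐ x, ∀ T ∈ coverSets d u, (∃ τ, x ∈ rectHull (cellBox S u κ τ)) →
      |mixedPartial T F x| ≤ (hNorm S u κ F).toReal := by
  have hU : MeasurableSet (⋃ τ, rectHull (cellBox S u κ τ)) :=
    MeasurableSet.iUnion fun τ => measurableSet_rectHull _
  have h : ∀ᵐ x ∂(volume.restrict (⋃ τ, rectHull (cellBox S u κ τ))),
      ‖hMax u F x‖ₑ ≤ hNorm S u κ F := by
    unfold hNorm
    rw [eLpNorm_exponent_top]
    exact ae_le_eLpNormEssSup
  rw [ae_restrict_iff' hU] at h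
  filter_upwards [h] with x hx T hT hxR
  have h1 := hx (mem_iUnion.2 hxR)
  have h2 : ‖mixedPartial T F x‖₊ ≤ (coverSets d u).sup fun v => ‖mixedPartial v F x‖₊ :=
    Finset.le_sup (f := fun v => ‖mixedPartial v F x‖₊) hT
  have h3 : |mixedPartial T F x| ≤ hMax u F x := by
    unfold hMax; exact_mod_cast h2
  refine h3.trans ?_
  rw [← ofReal_norm, ENNReal.ofReal_le_iff_le_toReal hN] at h1
  exact (le_abs_self _).trans h1

theorem prod_const_mul_rpow (hb : 2 ≤ b) (C : ℝ) :
    ∏ j : u, (C ^ d * (b : ℝ) ^ (-(κ j : ℝ) / (d : ℝ))) =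
      (C ^ d) ^ u.card * (b : ℝ) ^ (-((∑ j, κ j : ℕ) : ℝ) / (d : ℝ)) := by
  have hb0 : (0 : ℝ) < b := by positivity
  rw [Finset.prod_mul_distrib, ← Real.rpow_sum_of_pos hb0]
  simp only [Finset.prod_const, Finset.card_univ, Fintype.card_coe, Nat.cast_sum]
  rw [← Finset.sum_div, Finset.sum_neg_distrib]

theorem const_sq_le (hd : 1 ≤ d) (hb : 2 ≤ b) {C : ℝ} {M : ℝ} (n k : ℕ) :
    (M * ((2 ^ d - 1) ^ n * ((C ^ d) ^ n * (b : ℝ) ^ (-(k : ℝ) / (d : ℝ)))) *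
        (2 - 2 / (b : ℝ)) ^ n) ^ 2 ≤
      ((((d : ℝ) ^ (1 / 2 : ℝ) * (2 ^ d - 1) * C ^ d) ^ 2 * (2 - 2 / (b : ℝ)) ^ 3) ^ n *
        (b : ℝ) ^ (-2 * (k : ℝ) / (d : ℝ))) * M ^ 2 := by
  have hb0 : (0 : ℝ) < b := by positivity
  have hb2 : (2 : ℝ) ≤ b := by exact_mod_cast hb
  have hq : 1 ≤ 2 - 2 / (b : ℝ) := by
    have : 2 / (b : ℝ) ≤ 1 := by rw [div_le_one hb0]; exact hb2
    linarith
  have hd1 : (1 : ℝ) ≤ d := by exact_mod_cast hd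
  have h2d : (0 : ℝ) ≤ 2 ^ d - 1 := by
    have : (1 : ℝ) ≤ 2 ^ d := one_le_pow₀ (by norm_num)
    linarith
  have hsq : ((d : ℝ) ^ (1 / 2 : ℝ)) ^ 2 = d := by
    rw [← Real.sqrt_eq_rpow, Real.sq_sqrt (by positivity)]
  have hexp : (b : ℝ) ^ (-2 * (k : ℝ) / (d : ℝ)) = ((b : ℝ) ^ (-(k : ℝ) / (d : ℝ))) ^ 2 := by
    rw [← Real.rpow_natCast, ← Real.rpow_mul hb0.le]; congr 1; push_cast; ring
  have e1 : (M * ((2 ^ d - 1) ^ n * ((C ^ d) ^ n * (b : ℝ) ^ (-(k : ℝ) / (d : ℝ)))) *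
        (2 - 2 / (b : ℝ)) ^ n) ^ 2 =
      (((2 ^ d - 1) * C ^ d) ^ 2 * (2 - 2 / (b : ℝ)) ^ 2) ^ n *
        ((b : ℝ) ^ (-(k : ℝ) / (d : ℝ))) ^ 2 * M ^ 2 := by
    generalize (2 : ℝ) ^ d - 1 = P, 2 - 2 / (b : ℝ) = Q, C ^ d = c, (b : ℝ) ^ (-(k : ℝ) / (d : ℝ)) = B
    ring
  rw [e1, hexp]
  refine mul_le_mul_of_nonneg_right (mul_le_mul_of_nonneg_right ?_ (sq_nonneg _)) (sq_nonneg _)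
  refine pow_le_pow_left₀ (by positivity) ?_ n
  refine mul_le_mul ?_ (pow_le_pow_right₀ hq (by norm_num)) (by positivity) (by positivity)
  rw [mul_assoc, mul_pow _ ((2 ^ d - 1) * C ^ d), hsq]
  exact le_mul_of_one_le_left (sq_nonneg _) hd1

/-- The variance bound for an extension `Ft` of a function `g` with the same coefficients as `f`,
when the mixed partial derivatives of `Ft` form almost everywhere an integral family. -/
theorem ofReal_sigmaSq_le (hd : 1 ≤ d) (hb : 2 ≤ b) (hX : ∀ j, Bornology.IsBounded (X j))
    (h1 : ∀ j, volume (X j) = 1) {C : ℝ} (hC : 1 ≤ C)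
    (hdiam : ∀ j k (t : Fin k → Fin b),
      Metric.diam ((S j).cell k t) ≤ C * (b : ℝ) ^ (-(k : ℝ) / (d : ℝ)))
    {f g Ft : Pt s d → ℝ}
    (hfg : ∀ τ γ, ∫ x in prodSet X, f x * psi S u κ τ γ x =
      ∫ x in prodSet X, g x * psi S u κ τ γ x)
    {G : Finset (Fin s × Fin d) → Pt s d → ℝ} (hm : ∀ T, Measurable (G T)) {K : ℝ}
    (hK : ∀ T x, |G T x| ≤ K) (hG : IsIntegralFamily (rectHull (prodSet X)) G)
    (h0 : EqOn (G ∅) g (prodSet X))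
    (hmix : ∀ T, ∀ᵐ x, x ∈ rectHull (prodSet X) → mixedPartial T Ft x = G T x) :
    ENNReal.ofReal (sigmaSq S f u κ) ≤
      ENNReal.ofReal
        ((((d : ℝ) ^ (1 / 2 : ℝ) * (2 ^ d - 1) * C ^ d) ^ 2 * (2 - 2 / (b : ℝ)) ^ 3) ^ u.card *
          (b : ℝ) ^ (-2 * ((∑ j, κ j : ℕ) : ℝ) / (d : ℝ))) * hNorm S u κ Ft ^ 2 := by
  have hb0 : (0 : ℝ) < b := by positivity
  have hb2 : (2 : ℝ) ≤ b := by exact_mod_cast hb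
  have hC0 : 0 < C := by linarith
  by_cases hN : hNorm S u κ Ft = ⊤
  · have hpos : 0 < ((((d : ℝ) ^ (1 / 2 : ℝ) * (2 ^ d - 1) * C ^ d) ^ 2 *
        (2 - 2 / (b : ℝ)) ^ 3) ^ u.card * (b : ℝ) ^ (-2 * ((∑ j, κ j : ℕ) : ℝ) / (d : ℝ))) := by
      have h2d : (0 : ℝ) < 2 ^ d - 1 := by
        have : (1 : ℝ) < 2 ^ d := one_lt_pow₀ (by norm_num) (by omega)
        linarith
      have hq : 0 < 2 - 2 / (b : ℝ) := by
        have : 2 / (b : ℝ) ≤ 1 := by rw [div_le_one hb0]; exact hb2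
        linarith
      have hd0 : (0 : ℝ) < d := by exact_mod_cast (by omega : 0 < d)
      positivity
    rw [hN, ENNReal.top_pow two_ne_zero, ENNReal.mul_top (by simpa using hpos)]
    exact le_top
  set M := (hNorm S u κ Ft).toReal with hM
  have hM0 : 0 ≤ M := ENNReal.toReal_nonneg
  have hmeas := measurableSet_prodSet fun j => (S j).measurableSet
  have hvol := volume_prodSet (fun j => (S j).measurableSet) h1
  have hsub : ∀ τ, rectHull (cellBox S u κ τ) ⊆ rectHull (prodSet X) := fun τ =>
    rectHull_mono (isBounded_prodSet hX) (cellBox_nonempty S u κ τ h1) (cellBox_subset S u κ τ)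
  let r : Fin s → ℝ := fun j =>
    if h : j ∈ u then C * (b : ℝ) ^ (-(κ ⟨j, h⟩ : ℝ) / (d : ℝ)) else 0
  let ρ : Fin s → ℝ := fun j =>
    if h : j ∈ u then C ^ d * (b : ℝ) ^ (-(κ ⟨j, h⟩ : ℝ) / (d : ℝ)) else 0
  have hr0 : ∀ j, 0 ≤ r j := fun j => by simp only [r]; split_ifs <;> positivity
  have hρ0 : ∀ j, 0 ≤ ρ j := fun j => by simp only [ρ]; split_ifs <;> positivity
  have hrρ : ∀ j ∈ u, ∀ m, 1 ≤ m → m ≤ d → r j ^ m ≤ ρ j := by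
    intro j hj m hm1 hmd
    simp only [r, ρ, hj, dite_true, mul_pow]
    refine mul_le_mul (pow_le_pow_right₀ hC hmd) (pow_le_of_le_one (by positivity) ?_ (by omega))
      (by positivity) (by positivity)
    exact Real.rpow_le_one_of_one_le_of_nonpos (by linarith)
      (div_nonpos_of_nonpos_of_nonneg (neg_nonpos.2 (Nat.cast_nonneg _)) (Nat.cast_nonneg _))
  have hsum := sum_coverSets_prod_le (d := d) u hr0 hrρ hρ0
  have hρprod : ∏ j ∈ u, ρ j =
      (C ^ d) ^ u.card * (b : ℝ) ^ (-((∑ j, κ j : ℕ) : ℝ) / (d : ℝ)) := by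
    rw [← prod_const_mul_rpow u κ hb C, ← Finset.prod_coe_sort]
    exact Finset.prod_congr rfl fun j _ => by simp [ρ]
  rw [hρprod] at hsum
  have hae : ∀ τ, ∀ᵐ x, ∀ T ∈ coverSets d u, x ∈ rectHull (cellBox S u κ τ) → |G T x| ≤ M := by
    intro τ
    filter_upwards [ae_abs_mixedPartial_le S u κ hN, ae_all_iff.2 hmix] with x hx hx' T hT hxR
    rw [← hx' T (hsub τ hxR)]
    exact hx T hT ⟨τ, hxR⟩
  have hfG : ∀ τ γ, ∫ x in prodSet X, f x * psi S u κ τ γ x =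
      ∫ x in prodSet X, G ∅ x * psi S u κ τ γ x := fun τ γ => by
    rw [hfg]
    exact setIntegral_congr_fun hmeas fun x hx => by simp only [h0 hx]
  set Bd := M * ((2 ^ d - 1) ^ u.card *
    ((C ^ d) ^ u.card * (b : ℝ) ^ (-((∑ j, κ j : ℕ) : ℝ) / (d : ℝ)))) *
      (2 - 2 / (b : ℝ)) ^ u.card with hBd
  have hnu : ∀ᵐ x, x ∈ prodSet X → |nu S f u κ x| ≤ Bd := by
    filter_upwards [ae_nu_eq S u κ hb h1 hfG (hm ∅) (hK ∅)] with x hx hxX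
    obtain ⟨τ, γ, h⟩ := hx hxX
    rw [h, abs_mul, abs_of_nonneg (Finset.prod_nonneg fun j _ => by positivity)]
    have hI := abs_inner_psi_le S u κ hb hX h1 τ γ hm hK (hG.mono (hsub τ)) hM0 (hae τ) (r := r)
      (fun x hx a ha p hp => by
        simpa [r, hp] using abs_sub_le_of_diam S u κ hX h1 hdiam τ hx ha hp)
    have hψ := setIntegral_abs_psi S u κ τ γ h1 hb
    have hψ0 : 0 ≤ ∫ x in prodSet X, |psi S u κ τ γ x| := integral_nonneg fun _ => abs_nonneg _
    calc (∏ j : u, (b : ℝ) ^ (((κ j : ℝ) + 1) / 2)) *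
          |∫ z in prodSet X, G ∅ z * psi S u κ τ γ z|
        ≤ (∏ j : u, (b : ℝ) ^ (((κ j : ℝ) + 1) / 2)) *
          (M * (∑ T ∈ coverSets d u, ∏ p ∈ T, r p.1) * ∫ x in prodSet X, |psi S u κ τ γ x|) :=
          mul_le_mul_of_nonneg_left hI (Finset.prod_nonneg fun j _ => by positivity)
      _ = M * (∑ T ∈ coverSets d u, ∏ p ∈ T, r p.1) * (2 - 2 / (b : ℝ)) ^ u.card := by
          rw [← hψ]; ring
      _ ≤ Bd := by
          refine mul_le_mul_of_nonneg_right (mul_le_mul_of_nonneg_left hsum hM0) ?_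
          rw [← hψ]
          exact mul_nonneg (Finset.prod_nonneg fun j _ => by positivity) hψ0
  have hσ : sigmaSq S f u κ ≤ Bd ^ 2 := by
    have := norm_setIntegral_le_of_norm_le_const_ae (μ := volume) (s := prodSet X)
      (f := fun x => nu S f u κ x ^ 2) (C := Bd ^ 2) (by simp [hvol]) (by
        rw [ae_restrict_iff' hmeas]
        filter_upwards [hnu] with x hx hxX
        rw [norm_pow]
        exact pow_le_pow_left₀ (norm_nonneg _) (hx hxX) 2)
    simp only [Measure.real, hvol, ENNReal.toReal_one, mul_one] at this
    exact (le_abs_self _).trans this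
  have hfin := hσ.trans (const_sq_le hd hb (C := C) (M := M) u.card (∑ j, κ j))
  calc ENNReal.ofReal (sigmaSq S f u κ) ≤ ENNReal.ofReal (_ * M ^ 2) := ENNReal.ofReal_le_ofReal hfin
    _ = _ := by
      rw [ENNReal.ofReal_mul' (sq_nonneg _), ENNReal.ofReal_pow hM0, hM, ENNReal.ofReal_toReal hN]

end Bound

section SmoothAlgebra

variable {ι : Type*} [DecidableEq ι] {A : Set (ι → ℝ)}

theorem SmoothOn.continuousOn {f : (ι → ℝ) → ℝ} (hf : SmoothOn A f) : ContinuousOn f A := by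
  obtain ⟨D, h0, hc, -⟩ := hf
  exact (hc ∅).congr h0.symm

theorem SmoothOn.sub {f g : (ι → ℝ) → ℝ} (hf : SmoothOn A f) (hg : SmoothOn A g) :
    SmoothOn A (fun x => f x - g x) := by
  obtain ⟨D, h0, hc, hd⟩ := hf
  obtain ⟨E, h0', hc', hd'⟩ := hg
  exact ⟨fun v x => D v x - E v x, fun x hx => by simp only [h0 hx, h0' hx],
    fun v => (hc v).sub (hc' v), fun v p hp x hx => (hd v p hp x hx).sub (hd' v p hp x hx)⟩

theorem SmoothOn.sum {α : Type*} {I : Finset α} {f : α → (ι → ℝ) → ℝ}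
    (hf : ∀ i ∈ I, SmoothOn A (f i)) : SmoothOn A (fun x => ∑ i ∈ I, f i x) := by
  choose! D h0 hc hd using hf
  refine ⟨fun v x => ∑ i ∈ I, D i v x, fun x hx => Finset.sum_congr rfl fun i hi => h0 i hi hx,
    fun v => continuousOn_finsetSum _ fun i hi => hc i hi v, fun v p hp x hx => ?_⟩
  exact HasDerivWithinAt.fun_sum fun i hi => hd i hi v p hp x hx

end SmoothAlgebra

section Average

variable {s d : ℕ} {X : Fin s → Set (EuclideanSpace ℝ (Fin d))}

/-- The integral over the blocks outside `u`. -/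
def blockIntegral (X : Fin s → Set (EuclideanSpace ℝ (Fin d))) (u : Finset (Fin s))
    (g : Pt s d → ℝ) (x : Pt s d) : ℝ :=
  ∫ y in sliceSet X uᶜ x, g (hybrid (coords d uᶜ) x y)

theorem notMem_coords_compl {u : Finset (Fin s)} {p : Fin s × Fin d} :
    p ∉ coords d uᶜ ↔ p ∈ coords d u := by simp [mem_coords]

theorem blockIntegral_congr {u : Finset (Fin s)} {g : Pt s d → ℝ} {x x' : Pt s d}
    (h : ∀ p ∈ coords d u, x p = x' p) : blockIntegral X u g x = blockIntegral X u g x' := by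
  unfold blockIntegral
  rw [sliceSet_congr uᶜ x x']
  congr 1; ext y
  rw [hybrid_congr fun p hp => h p (notMem_coords_compl.1 hp)]

theorem hybrid_mem_prodSet {u : Finset (Fin s)} {x x' : Pt s d} (hx : x ∈ prodSet X)
    {y : ↥(coords d u) → ℝ} (hy : y ∈ sliceSet X u x') : hybrid (coords d u) x y ∈ prodSet X :=
  hybrid_mem_prodSet_iff.2 ⟨fun j _ => hx j, by rwa [sliceSet_congr u x x']⟩

theorem anova_eq (f : Pt s d → ℝ) (u : Finset (Fin s)) :
    anova X f u = blockIntegral X u fun x => f x - ∑ v ∈ u.ssubsets, anova X f v x := by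
  ext x
  rw [anova, blockIntegral]
  congr 2
  · congr 1; ext y; simp
  · ext y
    rw [Finset.sum_attach u.ssubsets fun v => anova X f v (hybrid (coords d uᶜ) x y)]

theorem anova_congr (f : Pt s d → ℝ) (u : Finset (Fin s)) {x x' : Pt s d}
    (h : ∀ p ∈ coords d u, x p = x' p) : anova X f u x = anova X f u x' := by
  rw [anova_eq]; exact blockIntegral_congr h

theorem continuousOn_slice {u : Finset (Fin s)} {g : Pt s d → ℝ} (hg : ContinuousOn g (prodSet X))
    {x : Pt s d} (hx : x ∈ prodSet X) (x' : Pt s d) :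
    ContinuousOn (fun y => g (hybrid (coords d u) x y)) (sliceSet X u x') :=
  ContinuousOn.comp (t := prodSet X) hg (continuous_hybrid_right _ x).continuousOn fun _ hy =>
    hybrid_mem_prodSet hx hy

variable (hX : ∀ j, MeasurableSet (X j)) (h1 : ∀ j, volume (X j) = 1)
  (hA : IsCompact (prodSet X))
include hX h1 hA

theorem integrableOn_slice {u : Finset (Fin s)} {g : Pt s d → ℝ}
    (hg : ContinuousOn g (prodSet X)) {x : Pt s d} (hx : x ∈ prodSet X) (x' : Pt s d) :
    IntegrableOn (fun y => g (hybrid (coords d u) x y)) (sliceSet X u x') := by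
  obtain ⟨K, hK⟩ := hA.exists_bound_of_continuousOn hg
  refine IntegrableOn.of_bound (C := K) (by simp [volume_sliceSet hX h1])
    ((continuousOn_slice hg hx x').aestronglyMeasurable (measurableSet_sliceSet hX u x')) ?_
  rw [ae_restrict_iff' (measurableSet_sliceSet hX u x')]
  exact Filter.Eventually.of_forall fun y hy => hK _ (hybrid_mem_prodSet hx hy)

theorem continuousOn_blockIntegral {u : Finset (Fin s)} {g : Pt s d → ℝ}
    (hg : ContinuousOn g (prodSet X)) : ContinuousOn (blockIntegral X u g) (prodSet X) := by
  obtain ⟨K, hK⟩ := hA.exists_bound_of_continuousOn hg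
  have hS := measurableSet_sliceSet hX uᶜ 0
  have e : blockIntegral X u g =
      fun x => ∫ y in sliceSet X uᶜ 0, g (hybrid (coords d uᶜ) x y) := by
    ext x; rw [blockIntegral, sliceSet_congr uᶜ x 0]
  rw [e]
  refine continuousOn_of_dominated (bound := fun _ => K) (fun x hx =>
    (continuousOn_slice hg hx 0).aestronglyMeasurable hS) (fun x hx => ?_) ?_ ?_
  · rw [ae_restrict_iff' hS]
    exact Filter.Eventually.of_forall fun y hy => hK _ (hybrid_mem_prodSet hx hy)
  · exact integrableOn_const (by simp [volume_sliceSet hX h1])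
  · rw [ae_restrict_iff' hS]
    refine Filter.Eventually.of_forall fun y hy => ?_
    exact ContinuousOn.comp (t := prodSet X) hg
      ((continuous_hybrid _).comp (continuous_id.prodMk continuous_const)).continuousOn
      fun x hx => hybrid_mem_prodSet hx hy

theorem hasPartialWithin_blockIntegral {u : Finset (Fin s)} {g g' : Pt s d → ℝ}
    (hg : ContinuousOn g (prodSet X)) (hg' : ContinuousOn g' (prodSet X)) {p : Fin s × Fin d}
    (hp : p ∈ coords d u)
    (hL : ∀ x ∈ prodSet X, ∀ t, Function.update x p t ∈ prodSet X →
      ∀ r ∈ uIcc t (x p), Function.update x p r ∈ prodSet X)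
    (hd : ∀ x ∈ prodSet X, HasPartialWithin (prodSet X) p g (g' x) x) {x : Pt s d}
    (hx : x ∈ prodSet X) :
    HasPartialWithin (prodSet X) p (blockIntegral X u g) (blockIntegral X u g' x) x := by
  obtain ⟨K, hK⟩ := hA.exists_bound_of_continuousOn hg'
  have hS := measurableSet_sliceSet hX uᶜ x
  have hp' : p ∉ coords d uᶜ := notMem_coords_compl.2 hp
  unfold HasPartialWithin
  rw [hasDerivWithinAt_iff_tendsto_slope]
  set L := {t | Function.update x p t ∈ prodSet X} with hLdef
  have hupd : ∀ y t, hybrid (coords d uᶜ) (Function.update x p t) y =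
      Function.update (hybrid (coords d uᶜ) x y) p t := fun y t =>
    hybrid_update_of_notMem hp' x t y
  have hpt : ∀ y ∈ sliceSet X uᶜ x, HasDerivWithinAt
      (fun t => g (hybrid (coords d uᶜ) (Function.update x p t) y))
      (g' (hybrid (coords d uᶜ) x y)) L (x p) := by
    intro y hy
    have h2 := hd _ (hybrid_mem_prodSet hx hy)
    unfold HasPartialWithin at h2
    rw [hybrid_of_notMem hp'] at h2
    simp_rw [← hupd] at h2
    exact h2.mono fun t ht => hybrid_mem_prodSet ht hy
  have hslope : ∀ t ∈ L, slope (fun t => blockIntegral X u g (Function.update x p t)) (x p) t =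
      ∫ y in sliceSet X uᶜ x,
        slope (fun t => g (hybrid (coords d uᶜ) (Function.update x p t) y)) (x p) t := by
    intro t ht
    simp only [slope_def_field, blockIntegral, Function.update_eq_self]
    rw [integral_div, integral_sub (integrableOn_slice hX h1 hA hg ht x)
      (integrableOn_slice hX h1 hA hg hx x), sliceSet_congr uᶜ (Function.update x p t) x]
  have hbd : ∀ t ∈ L, ∀ y ∈ sliceSet X uᶜ x,
      ‖slope (fun t => g (hybrid (coords d uᶜ) (Function.update x p t) y)) (x p) t‖ ≤ K := by
    intro t ht y hy
    have hseg : uIcc t (x p) ⊆ L := fun r hr => hL x hx t ht r hr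
    have hder : ∀ r ∈ uIcc t (x p), HasDerivWithinAt
        (fun t => g (hybrid (coords d uᶜ) (Function.update x p t) y))
        (g' (hybrid (coords d uᶜ) (Function.update x p r) y)) (uIcc t (x p)) r := by
      intro r hr
      have h2 := hd _ (hybrid_mem_prodSet (hseg hr) hy)
      unfold HasPartialWithin at h2
      rw [hupd] at h2
      simp only [Function.update_idem, Function.update_self] at h2
      simp_rw [← hupd] at h2
      exact h2.mono fun q hq => hybrid_mem_prodSet (hseg hq) hy
    have hmv := Convex.norm_image_sub_le_of_norm_hasDerivWithin_le hder
      (fun r hr => hK _ (hybrid_mem_prodSet (hseg hr) hy)) (convex_uIcc _ _)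
      right_mem_uIcc left_mem_uIcc
    rw [slope_def_field, norm_div]
    exact div_le_of_le_mul₀ (norm_nonneg _) ((norm_nonneg _).trans (hK x hx)) hmv
  have hmain : Filter.Tendsto (fun t => ∫ y in sliceSet X uᶜ x,
      slope (fun t => g (hybrid (coords d uᶜ) (Function.update x p t) y)) (x p) t)
      (nhdsWithin (x p) (L \ {x p})) (nhds (blockIntegral X u g' x)) := by
    refine tendsto_integral_filter_of_dominated_convergence (fun _ => K) ?_ ?_ ?_ ?_
    · filter_upwards [self_mem_nhdsWithin] with t ht
      simp only [slope_def_field, Function.update_eq_self]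
      exact ((((continuousOn_slice hg ht.1 x).sub
        (continuousOn_slice hg hx x)).div_const _).aestronglyMeasurable hS)
    · filter_upwards [self_mem_nhdsWithin] with t ht
      rw [ae_restrict_iff' hS]
      exact Filter.Eventually.of_forall fun y hy => hbd t ht.1 y hy
    · exact integrableOn_const (by simp [volume_sliceSet hX h1])
    · rw [ae_restrict_iff' hS]
      exact Filter.Eventually.of_forall fun y hy =>
        hasDerivWithinAt_iff_tendsto_slope.1 (hpt y hy)
  refine hmain.congr' ?_
  filter_upwards [self_mem_nhdsWithin] with t ht
  exact (hslope t ht.1).symm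

theorem SmoothOn.blockIntegral {u : Finset (Fin s)} {g : Pt s d → ℝ}
    (hL : ∀ p, ∀ x ∈ prodSet X, ∀ t, Function.update x p t ∈ prodSet X →
      ∀ r ∈ uIcc t (x p), Function.update x p r ∈ prodSet X)
    (hg : SmoothOn (prodSet X) g) : SmoothOn (prodSet X) (blockIntegral X u g) := by
  classical
  obtain ⟨D, h0, hc, hd⟩ := hg
  refine ⟨fun v => if v ⊆ coords d u then ScrambledGeometric.blockIntegral X u (D v) else 0,
    ?_, ?_, ?_⟩
  · intro x hx
    simp only [Finset.empty_subset, if_true, ScrambledGeometric.blockIntegral]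
    exact setIntegral_congr_fun (measurableSet_sliceSet hX uᶜ x) fun y hy =>
      h0 (hybrid_mem_prodSet hx hy)
  · intro v
    beta_reduce
    split_ifs
    · exact continuousOn_blockIntegral hX h1 hA (hc v)
    · exact continuousOn_const
  · intro v p hp x hx
    by_cases hv : v ⊆ coords d u
    · by_cases hpu : p ∈ coords d u
      · simp only [hv, Finset.insert_subset_iff, hpu, and_self, if_true]
        exact hasPartialWithin_blockIntegral hX h1 hA (hc v) (hc _) hpu (hL p) (hd v p hp) hx
      · simp only [hv, Finset.insert_subset_iff, hpu, false_and, if_true, if_false]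
        unfold HasPartialWithin
        have : (fun t => ScrambledGeometric.blockIntegral X u (D v) (Function.update x p t)) =
            fun _ => ScrambledGeometric.blockIntegral X u (D v) x := by
          ext t
          refine blockIntegral_congr fun q hq => ?_
          rw [Function.update_of_ne]; rintro rfl; exact hpu hq
        rw [this]
        exact hasDerivWithinAt_const _ _ _
    · simp only [hv, Finset.insert_subset_iff, and_false, if_false]
      exact hasDerivWithinAt_const _ _ _

theorem SmoothOn.anova {f : Pt s d → ℝ}
    (hL : ∀ p, ∀ x ∈ prodSet X, ∀ t, Function.update x p t ∈ prodSet X →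
      ∀ r ∈ uIcc t (x p), Function.update x p r ∈ prodSet X)
    (hf : SmoothOn (prodSet X) f) (u : Finset (Fin s)) :
    SmoothOn (prodSet X) (anova X f u) := by
  induction u using Finset.strongInduction with
  | H u ih =>
    rw [anova_eq]
    exact SmoothOn.blockIntegral hX h1 hA hL
      (hf.sub (SmoothOn.sum fun v hv => ih v (Finset.mem_ssubsets.1 hv)))

theorem continuousOn_anova {f : Pt s d → ℝ} (hf : ContinuousOn f (prodSet X))
    (u : Finset (Fin s)) : ContinuousOn (anova X f u) (prodSet X) := by
  induction u using Finset.strongInduction with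
  | H u ih =>
    rw [anova_eq]
    exact continuousOn_blockIntegral hX h1 hA
      (hf.sub (continuousOn_finsetSum _ fun v hv => ih v (Finset.mem_ssubsets.1 hv)))

omit h1 hA in
theorem setIntegral_blockIntegral (h1 : ∀ j, volume (X j) = 1) {u : Finset (Fin s)}
    {φ : Pt s d → ℝ} (hφ : IntegrableOn φ (prodSet X)) :
    ∫ x in prodSet X, blockIntegral X u φ x = ∫ x in prodSet X, φ x := by
  have hmeas := measurableSet_prodSet hX
  set W := coords d uᶜ with hW
  let F := (prodSet X).indicator φ
  let β : ({p // p ∉ W} → ℝ) → ℝ := fun z => ∫ y : W → ℝ, F ((splitEquiv W).symm (y, z))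
  have hFint : Integrable (fun q => F ((splitEquiv W).symm q))
      ((volume : Measure (W → ℝ)).prod (volume : Measure ({p // p ∉ W} → ℝ))) :=
    (measurePreserving_splitEquiv W).symm.integrable_comp_emb
      (splitEquiv W).symm.measurableEmbedding |>.2 ((integrable_indicator_iff hmeas).2 hφ)
  have hβ : ∫ z, β z = ∫ x, F x := by
    have := (measurePreserving_splitEquiv W).symm.integral_comp' (f := (splitEquiv W).symm) F
    rw [← this, Measure.volume_eq_prod, integral_prod_symm _ hFint]
  have hpt : ∀ x : Pt s d, (prodSet X).indicator (blockIntegral X u φ) x =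
      (sliceSet X uᶜ 0).indicator 1 (fun p : W => x p) * β (fun p : {p // p ∉ W} => x p) := by
    intro x
    have hxx : hybrid W x (fun p : W => x p) = x := by
      rw [hybrid_restrict]; ext p; by_cases hp : p ∈ W <;> simp [hp]
    have hiff : x ∈ prodSet X ↔ (∀ j ∉ uᶜ, block x j ∈ X j) ∧
        (fun p : W => x p) ∈ sliceSet X uᶜ 0 := by
      rw [sliceSet_congr uᶜ 0 x, ← hybrid_mem_prodSet_iff (u := uᶜ) (x := x), hxx]
    have hβx : β (fun p : {p // p ∉ W} => x p) = ∫ y : W → ℝ, F (hybrid W x y) := by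
      simp only [β, splitEquiv_symm_eq_hybrid]
    rw [hβx]
    by_cases hr : ∀ j ∉ uᶜ, block x j ∈ X j
    · have e : ∫ y : W → ℝ, F (hybrid W x y) = blockIntegral X u φ x := by
        rw [blockIntegral, ← integral_indicator (measurableSet_sliceSet hX uᶜ x)]
        congr 1; ext y
        by_cases hy : y ∈ sliceSet X uᶜ x
        · rw [indicator_of_mem hy]
          exact indicator_of_mem (hybrid_mem_prodSet_iff.2 ⟨hr, hy⟩) _
        · rw [indicator_of_notMem hy]
          exact indicator_of_notMem (fun h => hy (hybrid_mem_prodSet_iff.1 h).2) _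
      rw [e]
      by_cases hy : (fun p : W => x p) ∈ sliceSet X uᶜ 0
      · rw [indicator_of_mem (hiff.2 ⟨hr, hy⟩), indicator_of_mem hy]; simp
      · rw [indicator_of_notMem fun h => hy (hiff.1 h).2, indicator_of_notMem hy]; simp
    · have e : ∫ y : W → ℝ, F (hybrid W x y) = 0 := by
        rw [← integral_zero (W → ℝ) ℝ (μ := volume)]
        congr 1; ext y
        exact indicator_of_notMem (fun h => hr (hybrid_mem_prodSet_iff.1 h).1) _
      rw [e, indicator_of_notMem fun h => hr (hiff.1 h).1, mul_zero]
  rw [← integral_indicator hmeas]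
  simp_rw [hpt]
  rw [integral_split_mul, hβ, integral_indicator_one (measurableSet_sliceSet hX uᶜ 0)]
  simp [Measure.real, volume_sliceSet hX h1, F, integral_indicator hmeas]

end Average

section AnovaInner

variable {s d b : ℕ} {X : Fin s → Set (EuclideanSpace ℝ (Fin d))}
  (S : ∀ j, RecursiveSplit b (X j)) (u : Finset (Fin s)) (κ : u → ℕ)
  (τ : ∀ j : u, Fin (κ j) → Fin b) (γ : u → Fin b)

theorem psi_congr {x x' : Pt s d} (h : ∀ p ∈ coords d u, x p = x' p) :
    psi S u κ τ γ x = psi S u κ τ γ x' :=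
  Finset.prod_congr rfl fun j _ => by rw [block_congr fun i => h (j.1, i) (mem_coords.2 j.2)]

theorem integrableOn_mul_psi (h1 : ∀ j, volume (X j) = 1) (hA : IsCompact (prodSet X))
    {g : Pt s d → ℝ} (hg : ContinuousOn g (prodSet X)) :
    IntegrableOn (fun x => g x * psi S u κ τ γ x) (prodSet X) := by
  obtain ⟨K, hK⟩ := hA.exists_bound_of_continuousOn hg
  obtain ⟨Kψ, hKψ⟩ := exists_bound_psi S u κ τ γ
  refine IntegrableOn.of_bound (C := K * Kψ)
    (by simp [volume_prodSet (fun j => (S j).measurableSet) h1])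
    ((hg.aestronglyMeasurable hA.measurableSet).mul
      (measurable_psi S u κ τ γ).aestronglyMeasurable) ?_
  rw [ae_restrict_iff' hA.measurableSet]
  refine Filter.Eventually.of_forall fun x hx => ?_
  rw [norm_mul]
  exact mul_le_mul (hK x hx) (hKψ x) (norm_nonneg _) ((norm_nonneg _).trans (hK x hx))

/-- The coefficients of `f` are those of its ANOVA component. -/
theorem setIntegral_mul_psi_eq_anova (hb : 2 ≤ b) (h1 : ∀ j, volume (X j) = 1)
    (hA : IsCompact (prodSet X)) {f : Pt s d → ℝ} (hf : ContinuousOn f (prodSet X)) :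
    ∫ x in prodSet X, f x * psi S u κ τ γ x =
      ∫ x in prodSet X, anova X f u x * psi S u κ τ γ x := by
  have hX : ∀ j, MeasurableSet (X j) := fun j => (S j).measurableSet
  have hc := fun v => continuousOn_anova hX h1 hA hf v
  have hs : ContinuousOn (fun x => f x - ∑ v ∈ u.ssubsets, anova X f v x) (prodSet X) :=
    hf.sub (continuousOn_finsetSum _ fun v _ => hc v)
  have e1 : ∀ x, anova X f u x * psi S u κ τ γ x = blockIntegral X u
      (fun x => (f x - ∑ v ∈ u.ssubsets, anova X f v x) * psi S u κ τ γ x) x := by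
    intro x
    rw [anova_eq]
    simp only [blockIntegral]
    rw [← integral_mul_const]
    congr 1; ext y
    congr 1
    exact psi_congr S u κ τ γ fun p hp =>
      (hybrid_of_notMem (notMem_coords_compl.2 hp) _ _).symm
  simp_rw [e1]
  rw [setIntegral_blockIntegral hX h1 (integrableOn_mul_psi S u κ τ γ h1 hA hs)]
  simp_rw [sub_mul, Finset.sum_mul]
  rw [integral_sub (integrableOn_mul_psi S u κ τ γ h1 hA hf)
    (integrable_finsetSum _ fun v _ => integrableOn_mul_psi S u κ τ γ h1 hA (hc v)),
    integral_finsetSum _ fun v _ => integrableOn_mul_psi S u κ τ γ h1 hA (hc v),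
    Finset.sum_eq_zero, sub_zero]
  intro v hv
  obtain ⟨j, hj, hjv⟩ := Finset.exists_of_ssubset (Finset.mem_ssubsets.1 hv)
  exact setIntegral_mul_psi_eq_zero S u κ τ γ h1 hb hj fun x x' h =>
    anova_congr f v fun p hp => h p (by rintro rfl; exact hjv (mem_coords.1 hp))

end AnovaInner

section PartialWithin

variable {ι : Type*} [DecidableEq ι] [Fintype ι] {R : Set (ι → ℝ)}

/-- The partial derivative within `R`. -/
def pderivWithin (R : Set (ι → ℝ)) (p : ι) (g : (ι → ℝ) → ℝ) : (ι → ℝ) → ℝ :=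
  fun x => fderivWithin ℝ g R x (Pi.single p 1)

theorem contDiffOn_pderivWithin (hR : UniqueDiffOn ℝ R) {g : (ι → ℝ) → ℝ} {m : ℕ}
    (hg : ContDiffOn ℝ ((m + 1 : ℕ) : WithTop ℕ∞) g R) (p : ι) :
    ContDiffOn ℝ (m : WithTop ℕ∞) (pderivWithin R p g) R :=
  (hg.fderivWithin hR (by norm_cast)).clm_apply contDiffOn_const

theorem hasPartialWithin_pderivWithin {g : (ι → ℝ) → ℝ} {x : ι → ℝ}
    (hg : DifferentiableWithinAt ℝ g R x) (p : ι) :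
    HasPartialWithin R p g (pderivWithin R p g x) x := by
  have h1 : HasFDerivWithinAt g (fderivWithin ℝ g R x) R (Function.update x p (x p)) := by
    rw [Function.update_eq_self]; exact hg.hasFDerivWithinAt
  exact h1.comp_hasDerivWithinAt (x p) (hasDerivAt_update x p (x p)).hasDerivWithinAt
    fun t ht => ht

theorem pderivWithin_congr {g g' : (ι → ℝ) → ℝ} (h : EqOn g g' R) (p : ι) :
    EqOn (pderivWithin R p g) (pderivWithin R p g') R := fun x hx => by
  unfold pderivWithin
  rw [fderivWithin_congr h (h hx)]

theorem pderivWithin_comm (hR : UniqueDiffOn ℝ R) (hcl : R ⊆ closure (interior R))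
    {g : (ι → ℝ) → ℝ} (hg : ContDiffOn ℝ 2 g R) (p q : ι) :
    EqOn (pderivWithin R p (pderivWithin R q g)) (pderivWithin R q (pderivWithin R p g)) R := by
  intro x hx
  have hd : DifferentiableWithinAt ℝ (fderivWithin ℝ g R) R x :=
    ((hg.fderivWithin hR (m := 1) (by norm_num)).differentiableOn (by norm_num)) x hx
  have key : ∀ p q, pderivWithin R p (pderivWithin R q g) x =
      fderivWithin ℝ (fderivWithin ℝ g R) R x (Pi.single p 1) (Pi.single q 1) := by
    intro p q
    unfold pderivWithin
    rw [fderivWithin_clm_apply (hR x hx) hd (differentiableWithinAt_const _)]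
    simp
  rw [key, key]
  exact ((hg x hx).isSymmSndFDerivWithinAt (by simp) hR (hcl hx) hx).eq _ _

theorem contDiffOn_foldr_pderivWithin (hR : UniqueDiffOn ℝ R) {g : (ι → ℝ) → ℝ} :
    ∀ (l : List ι) (m : ℕ), ContDiffOn ℝ ((m + l.length : ℕ) : WithTop ℕ∞) g R →
      ContDiffOn ℝ (m : WithTop ℕ∞) (l.foldr (pderivWithin R) g) R := by
  intro l
  induction l with
  | nil => intro m hg; simpa using hg
  | cons p l ih =>
    intro m hg
    refine contDiffOn_pderivWithin hR (ih (m + 1) ?_) p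
    convert hg using 2
    rw [List.length_cons]; ring

theorem foldr_pderivWithin_perm (hR : UniqueDiffOn ℝ R) (hcl : R ⊆ closure (interior R))
    {g : (ι → ℝ) → ℝ} {n : ℕ} (hg : ContDiffOn ℝ (n : WithTop ℕ∞) g R) {l l' : List ι}
    (h : l.Perm l') : l.length ≤ n →
      EqOn (l.foldr (pderivWithin R) g) (l'.foldr (pderivWithin R) g) R := by
  induction h with
  | nil => intro _; exact fun _ _ => rfl
  | cons p _ ih =>
    intro hl
    rw [List.length_cons] at hl
    exact pderivWithin_congr (ih (by omega)) p
  | swap p q l =>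
    intro hl
    simp only [List.length_cons] at hl
    refine pderivWithin_comm hR hcl ?_ _ _
    exact contDiffOn_foldr_pderivWithin hR l 2 (hg.of_le (by exact_mod_cast (by omega)))
  | trans h1 _ ih1 ih2 =>
    intro hl
    exact (ih1 hl).trans (ih2 (h1.length_eq ▸ hl))

end PartialWithin

section CmExtension

variable {s d : ℕ}

theorem smoothOn_of_contDiffOn {R : Set (Pt s d)} (hR : UniqueDiffOn ℝ R)
    (hcl : R ⊆ closure (interior R)) {F : Pt s d → ℝ}
    (hF : ContDiffOn ℝ ((s * d : ℕ) : WithTop ℕ∞) F R) : SmoothOn R F := by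
  have hlen : ∀ v : Finset (Fin s × Fin d), (coordList v).length = v.card := fun v => by
    rw [← List.toFinset_card_of_nodup (nodup_coordList v), toFinset_coordList]
  have hcard : ∀ v : Finset (Fin s × Fin d), v.card ≤ s * d := fun v => by
    simpa using Finset.card_le_univ v
  refine ⟨fun v => (coordList v).foldr (pderivWithin R) F, ?_, fun v => ?_, fun v p hp x hx => ?_⟩
  · have : coordList (∅ : Finset (Fin s × Fin d)) = [] := by simp [coordList]
    simp only [this]
    exact fun _ _ => rfl
  · refine (contDiffOn_foldr_pderivWithin hR (coordList v) 0 (hF.of_le ?_)).continuousOn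
    rw [hlen]
    exact_mod_cast (by simpa using hcard v)
  · have hc : v.card + 1 ≤ s * d := by
      rw [← Finset.card_insert_of_notMem hp]; exact hcard _
    have h1 : ContDiffOn ℝ ((1 : ℕ) : WithTop ℕ∞) ((coordList v).foldr (pderivWithin R) F) R := by
      refine contDiffOn_foldr_pderivWithin hR (coordList v) 1 (hF.of_le ?_)
      rw [hlen]
      exact_mod_cast (by omega)
    have h2 := hasPartialWithin_pderivWithin (h1.differentiableOn (by norm_num) x hx) p
    have hperm : (coordList (insert p v)).Perm (p :: coordList v) := by
      rw [List.perm_ext_iff_of_nodup (nodup_coordList _)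
        (List.nodup_cons.2 ⟨by simpa [mem_coordList] using hp, nodup_coordList v⟩)]
      intro q; simp [mem_coordList]
    beta_reduce
    rw [foldr_pderivWithin_perm hR hcl hF hperm (by rw [hlen]; exact hcard _) hx]
    exact h2

end CmExtension

section CaseTwo

variable {s d b : ℕ} {X : Fin s → Set (EuclideanSpace ℝ (Fin d))}
  (S : ∀ j, RecursiveSplit b (X j)) (u : Finset (Fin s)) (κ : u → ℕ)

theorem isCompact_prodSet (hX : ∀ j, Bornology.IsBounded (X j)) (hc : ∀ j, IsClosed (X j)) :
    IsCompact (prodSet X) := by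
  refine Metric.isCompact_of_isClosed_isBounded ?_ (isBounded_prodSet hX)
  have : prodSet X = ⋂ j, (fun x => block x j) ⁻¹' X j := by ext; simp [prodSet]
  rw [this]
  exact isClosed_iInter fun j => (hc j).preimage (continuous_block j)

theorem interior_prodSet_nonempty (h : ∀ j, (interior (X j)).Nonempty) :
    (interior (prodSet X)).Nonempty := by
  choose z hz using h
  have ho : IsOpen (⋂ j, (fun x : Pt s d => block x j) ⁻¹' interior (X j)) :=
    isOpen_iInter_of_finite fun j => isOpen_interior.preimage (continuous_block j)
  refine ⟨fun p => z p.1 p.2, interior_maximal (fun x hx j => ?_) ho (mem_iInter.2 fun j => hz j)⟩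
  exact interior_subset (mem_iInter.1 hx j)

theorem CmOn.continuousOn {ι : Type*} [DecidableEq ι] [Fintype ι] {m : ℕ} {A : Set (ι → ℝ)}
    {f : (ι → ℝ) → ℝ} (h : CmOn m A f) : ContinuousOn f A := by
  obtain ⟨D, h0, hc, -⟩ := h
  exact (hc 0 (by simp)).congr h0.symm

theorem ofReal_sigmaSq_le_of_isCmExtension (hd : 1 ≤ d) (hb : 2 ≤ b)
    (hX : ∀ j, Bornology.IsBounded (X j)) (h1 : ∀ j, volume (X j) = 1) {C : ℝ} (hC : 1 ≤ C)
    (hdiam : ∀ j k (t : Fin k → Fin b),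
      Metric.diam ((S j).cell k t) ≤ C * (b : ℝ) ^ (-(k : ℝ) / (d : ℝ)))
    (hcl : ∀ j, IsClosed (X j)) (hint : ∀ j, (interior (X j)).Nonempty)
    {f F : Pt s d → ℝ} (hf : ContinuousOn f (prodSet X))
    (hF : IsCmExtension (s * d) (prodSet X) (anova X f u) F) :
    ENNReal.ofReal (sigmaSq S f u κ) ≤
      ENNReal.ofReal
        ((((d : ℝ) ^ (1 / 2 : ℝ) * (2 ^ d - 1) * C ^ d) ^ 2 * (2 - 2 / (b : ℝ)) ^ 3) ^ u.card *
          (b : ℝ) ^ (-2 * ((∑ j, κ j : ℕ) : ℝ) / (d : ℝ))) * hNorm S u κ F ^ 2 := by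
  have hA := isCompact_prodSet hX hcl
  have hsub := subset_rectHull (isBounded_prodSet hX)
  set R := rectHull (prodSet X) with hR
  have hconv : Convex ℝ R := convex_Icc _ _
  have hne : (interior R).Nonempty :=
    (interior_prodSet_nonempty hint).mono (interior_mono hsub)
  have hcomp : IsCompact R := isCompact_Icc
  have hcli : R ⊆ closure (interior R) := by
    rw [hconv.closure_interior_eq_closure_of_nonempty_interior hne]; exact subset_closure
  obtain ⟨G, h0, hm, ⟨K, hK⟩, hc, -, hder⟩ :=
    (smoothOn_of_contDiffOn (uniqueDiffOn_convex hconv hne) hcli hF.1).exists_family hcomp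
  refine ofReal_sigmaSq_le S u κ hd hb hX h1 hC hdiam
    (fun τ γ => setIntegral_mul_psi_eq_anova S u κ τ γ hb h1 hA hf) hm hK
    (isIntegralFamily_of_hasPartialWithin hc hder) ((h0.mono hsub).trans hF.2) fun T => ?_
  have hfr : ∀ᵐ x, x ∉ frontier R := measure_eq_zero_iff_ae_notMem.1 (hconv.addHaar_frontier _)
  filter_upwards [hfr] with x hx hxR
  have hxi : x ∈ interior R := by
    by_contra h
    exact hx ⟨subset_closure hxR, h⟩
  rw [mixedPartial_eq_foldr, foldr_pderiv_eq h0 hder interior_subset (w := Finset.univ)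
    (fun x hx p _ => ?_) (coordList T) (nodup_coordList T) (fun _ _ => Finset.mem_univ _) x hxi,
    toFinset_coordList]
  have : Filter.Tendsto (fun t => Function.update x p t) (nhds (x p)) (nhds x) := by
    have h2 : Continuous fun t => Function.update x p t := continuous_const.update p continuous_id
    simpa using h2.tendsto (x p)
  exact this.eventually (isOpen_interior.mem_nhds hx)

end CaseTwo

section Frontier

variable {ι : Type*} [Fintype ι]

/-- A set that contains the box spanned by `c` and any of its points has a null frontier. -/
theorem volume_frontier_eq_zero {B : Set (ι → ℝ)} {c : ι → ℝ}
    (hB : ∀ x ∈ B, {y : ι → ℝ | ∀ p, y p ∈ uIcc (c p) (x p)} ⊆ B) : volume (frontier B) = 0 := by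
  let sg : Bool → ℝ := fun e => if e then 1 else -1
  let φ : (ι → Bool) → (ι → ℝ) → ι → ℝ := fun σ x p => c p + sg (σ p) * max (x p) 0
  let m : (ι → Bool) → (ι → ℝ) → ι → ℝ := fun σ x p => sg (σ p) * (x p - c p)
  have hL : ∀ σ, IsLowerSet (φ σ ⁻¹' B) := by
    intro σ x y hyx hx
    refine hB _ hx fun p => ?_
    have h1 := hyx p
    have h2 : max (y p) 0 ≤ max (x p) 0 := max_le_max h1 le_rfl
    have h3 : 0 ≤ max (y p) 0 := le_max_right _ _
    simp only [φ, sg]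
    rw [mem_uIcc]
    by_cases hσ : σ p
    · left; simp only [hσ, if_true]; constructor <;> linarith
    · right; simp only [hσ, if_false, Bool.false_eq_true]; constructor <;> linarith
  have hm : ∀ σ, MeasurePreserving (m σ) volume volume := by
    intro σ
    refine volume_preserving_pi (f := fun p (t : ℝ) => sg (σ p) * (t - c p)) fun p => ?_
    by_cases hσ : σ p
    · simpa [sg, hσ] using measurePreserving_sub_right volume (c p)
    · simpa [sg, hσ] using Measure.measurePreserving_sub_left volume (c p)
  have hmc : ∀ σ, Continuous (m σ) := fun σ => by fun_prop
  have hnull : ∀ᵐ x : ι → ℝ, ∀ σ, m σ x ∉ frontier (φ σ ⁻¹' B) := ae_all_iff.2 fun σ =>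
    (hm σ).quasiMeasurePreserving.ae (measure_eq_zero_iff_ae_notMem.1 (hL σ).null_frontier)
  have hne : ∀ᵐ x : ι → ℝ, ∀ p, x p ≠ c p := ae_all_iff.2 fun p =>
    (Measure.quasiMeasurePreserving_eval (fun _ : ι => (volume : Measure ℝ)) p).ae
      (measure_eq_zero_iff_ae_notMem.1 (measure_singleton (c p)))
  rw [measure_eq_zero_iff_ae_notMem]
  filter_upwards [hnull, hne] with x hx hxc hxB
  let σ : ι → Bool := fun p => decide (c p < x p)
  have hUo : IsOpen {y : ι → ℝ | ∀ p, 0 < sg (σ p) * (y p - c p)} := by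
    simp only [ofPred_forall]
    exact isOpen_iInter_of_finite fun p => isOpen_lt continuous_const (by fun_prop)
  set U := {y : ι → ℝ | ∀ p, 0 < sg (σ p) * (y p - c p)} with hU
  have hxU : x ∈ U := by
    intro p
    by_cases h : c p < x p
    · simp [σ, sg, h]
    · have := lt_of_le_of_ne (not_lt.1 h) (hxc p)
      simp [σ, sg, h, this]
  have hsg : ∀ e, sg e * sg e = 1 := by intro e; cases e <;> simp [sg]
  have hUB : B ∩ U = (m σ ⁻¹' (φ σ ⁻¹' B)) ∩ U := by
    ext y
    refine and_congr_left fun hy => ?_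
    have : φ σ (m σ y) = y := by
      ext p
      simp only [φ, m]
      rw [max_eq_left (hy p).le, ← mul_assoc, hsg]; ring
    rw [mem_preimage, mem_preimage, this]
  have h1 : x ∈ frontier (m σ ⁻¹' (φ σ ⁻¹' B)) ∩ U := by
    rw [← frontier_inter_open_inter hUo, ← hUB, frontier_inter_open_inter hUo]
    exact ⟨hxB, hxU⟩
  exact hx σ ((hmc σ).frontier_preimage_subset _ h1.1)

end Frontier

section IteratedIntegral

variable {ι : Type*} [DecidableEq ι] {Ψ : (ι → ℝ) → ℝ} {K : ℝ} {w T : Finset ι} {p : ι}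
  (c : ι → ℝ)

/-- The mixed partial derivative in the coordinates of `T` of the signed integral of `Ψ` in the
coordinates of `w`. -/
def partialIntegral (w T : Finset ι) (c : ι → ℝ) (Ψ : (ι → ℝ) → ℝ) (x : ι → ℝ) : ℝ :=
  if T ⊆ w then signedIntegral (w \ T) c x Ψ x else 0

theorem signedIntegral_update {v : Finset ι} (hp : p ∉ v) (x : ι → ℝ) (t : ℝ) (z : ι → ℝ) :
    signedIntegral v c (Function.update x p t) Ψ z = signedIntegral v c x Ψ z :=
  signedIntegral_congr (fun q hq => by
    rw [Function.update_of_ne]; rintro rfl; exact hp hq) fun _ _ => rfl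

theorem signedIntegral_base_update {v : Finset ι} (hp : p ∈ v) (x : ι → ℝ) (t : ℝ) (z : ι → ℝ) :
    signedIntegral v c x Ψ (Function.update z p t) = signedIntegral v c x Ψ z :=
  signedIntegral_congr (fun _ _ => rfl) fun y _ => by rw [hybrid_update_of_mem hp]

theorem partialIntegral_insert (hTw : T ⊆ w) (hpw : p ∈ w) (x : ι → ℝ) (t : ℝ) :
    partialIntegral w (insert p T) c Ψ (Function.update x p t) =
      signedIntegral (w \ insert p T) c x Ψ (Function.update x p t) := by
  rw [partialIntegral, if_pos (Finset.insert_subset hpw hTw), signedIntegral_update]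
  simp

theorem partialIntegral_eq_integral (hΨ : Measurable Ψ) (hK : ∀ x, |Ψ x| ≤ K) (hTw : T ⊆ w)
    (hpw : p ∈ w) (hpT : p ∉ T) (x : ι → ℝ) (r : ℝ) :
    partialIntegral w T c Ψ (Function.update x p r) =
      ∫ t in (c p)..r, partialIntegral w (insert p T) c Ψ (Function.update x p t) := by
  have e : w \ T = insert p (w \ insert p T) := by
    ext q; by_cases hq : q = p <;> simp [hq, hpw, hpT]
  simp_rw [partialIntegral_insert c hTw hpw]
  rw [partialIntegral, if_pos hTw, signedIntegral_base_update c (by simp [hpw, hpT]), e,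
    signedIntegral_insert (by simp) c _ x hΨ hK, Function.update_self]
  refine intervalIntegral.integral_congr fun t _ => ?_
  exact signedIntegral_update c (by simp) x r _

theorem intervalIntegrable_partialIntegral (hΨ : Measurable Ψ) (hK : ∀ x, |Ψ x| ≤ K) (hTw : T ⊆ w)
    (hpw : p ∈ w) (x : ι → ℝ) (a b : ℝ) :
    IntervalIntegrable (fun t => partialIntegral w (insert p T) c Ψ (Function.update x p t))
      volume a b := by
  simp_rw [partialIntegral_insert c hTw hpw]
  exact intervalIntegrable_signedIntegral _ c x x p hΨ hK a b

theorem partialIntegral_update_of_notMem (hpw : p ∉ w)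
    (hcyl : ∀ x t, Ψ (Function.update x p t) = Ψ x) (x : ι → ℝ) (t : ℝ) :
    partialIntegral w T c Ψ (Function.update x p t) = partialIntegral w T c Ψ x := by
  unfold partialIntegral
  split_ifs
  · refine signedIntegral_congr (fun q hq => ?_) fun y _ => ?_
    · rw [Function.update_of_ne]; rintro rfl; exact hpw (Finset.mem_sdiff.1 hq).1
    · rw [hybrid_update_of_notMem (fun h => hpw (Finset.mem_sdiff.1 h).1), hcyl]
  · rfl

theorem intervalIntegrable_partialIntegral' (hΨ : Measurable Ψ) (hK : ∀ x, |Ψ x| ≤ K)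
    (x : ι → ℝ) (a b : ℝ) :
    IntervalIntegrable (fun t => partialIntegral w (insert p T) c Ψ (Function.update x p t))
      volume a b := by
  by_cases h : insert p T ⊆ w
  · rw [Finset.insert_subset_iff] at h
    exact intervalIntegrable_partialIntegral c hΨ hK h.2 h.1 x a b
  · simp [partialIntegral, h]

theorem partialIntegral_sub (hΨ : Measurable Ψ) (hK : ∀ x, |Ψ x| ≤ K)
    (hcyl : ∀ q ∉ w, ∀ x t, Ψ (Function.update x q t) = Ψ x) (hpT : p ∉ T) (x : ι → ℝ) (r : ℝ) :
    partialIntegral w T c Ψ x - partialIntegral w T c Ψ (Function.update x p r) =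
      ∫ t in r..(x p), partialIntegral w (insert p T) c Ψ (Function.update x p t) := by
  by_cases hTw : T ⊆ w
  · by_cases hpw : p ∈ w
    · have h1 := partialIntegral_eq_integral c hΨ hK hTw hpw hpT x (x p)
      rw [Function.update_eq_self] at h1
      rw [h1, partialIntegral_eq_integral c hΨ hK hTw hpw hpT,
        intervalIntegral.integral_interval_sub_left] <;>
      exact intervalIntegrable_partialIntegral c hΨ hK hTw hpw _ _ _
    · rw [partialIntegral_update_of_notMem c hpw (hcyl p hpw), sub_self]
      simp [partialIntegral, Finset.insert_subset_iff, hpw]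
  · simp [partialIntegral, Finset.insert_subset_iff, hTw]

theorem hasDerivAt_partialIntegral (hΨ : Measurable Ψ) (hK : ∀ x, |Ψ x| ≤ K)
    (hcyl : ∀ q ∉ w, ∀ x t, Ψ (Function.update x q t) = Ψ x) (hpT : p ∉ T) {x : ι → ℝ}
    (hx : ∀ᵐ y : ↥(w \ insert p T) → ℝ, ContinuousAt Ψ (hybrid (w \ insert p T) x y)) :
    HasDerivAt (fun t => partialIntegral w T c Ψ (Function.update x p t))
      (partialIntegral w (insert p T) c Ψ x) (x p) := by
  by_cases hTw : T ⊆ w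
  · by_cases hpw : p ∈ w
    · simp_rw [partialIntegral_eq_integral c hΨ hK hTw hpw hpT]
      have hcont : ContinuousAt
          (fun t => partialIntegral w (insert p T) c Ψ (Function.update x p t)) (x p) := by
        simp_rw [partialIntegral_insert c hTw hpw]
        unfold signedIntegral
        refine ContinuousAt.mul continuousAt_const (continuousAt_of_dominated (bound := fun _ => K)
          ?_ ?_ ?_ (ae_restrict_of_ae ?_))
        · exact Filter.Eventually.of_forall fun t =>
            (hΨ.comp (measurable_hybrid_right _ _)).aestronglyMeasurable
        · exact Filter.Eventually.of_forall fun t => Filter.Eventually.of_forall fun y => hK _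
        · exact integrableOn_const (by rw [volume_spanBox]; exact ENNReal.ofReal_ne_top)
        · filter_upwards [hx] with y hy
          have h2 : Continuous fun t => hybrid (w \ insert p T) (Function.update x p t) y :=
            (continuous_hybrid _).comp
              ((continuous_const.update p continuous_id).prodMk continuous_const)
          refine ContinuousAt.comp (g := Ψ) ?_ h2.continuousAt
          rwa [Function.update_eq_self]
      have hmeas : Measurable
          (fun t => partialIntegral w (insert p T) c Ψ (Function.update x p t)) := by
        simp_rw [partialIntegral_insert c hTw hpw]
        exact measurable_signedIntegral _ c hΨ measurable_const (measurable_update x)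
      have := intervalIntegral.integral_hasDerivAt_right
        (intervalIntegrable_partialIntegral c hΨ hK hTw hpw x (c p) (x p))
        hmeas.stronglyMeasurable.stronglyMeasurableAtFilter hcont
      rwa [Function.update_eq_self] at this
    · simp_rw [partialIntegral_update_of_notMem c hpw (hcyl p hpw)]
      have : partialIntegral w (insert p T) c Ψ x = 0 := by
        simp [partialIntegral, Finset.insert_subset_iff, hpw]
      rw [this]
      exact hasDerivAt_const _ _
  · have h1 : ¬ insert p T ⊆ w := fun h => hTw ((Finset.subset_insert p T).trans h)
    simp only [partialIntegral, hTw, h1, if_false]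
    exact hasDerivAt_const _ _

theorem measurable_partialIntegral (hΨ : Measurable Ψ) : Measurable (partialIntegral w T c Ψ) := by
  unfold partialIntegral
  split_ifs
  · exact measurable_signedIntegral _ c hΨ measurable_id measurable_id
  · exact measurable_const

end IteratedIntegral

section Anchored

variable {ι : Type*} [DecidableEq ι]

/-- The cylinder over the slice of `A` through `c` in the coordinates of `w`. -/
def sliceCylinder (A : Set (ι → ℝ)) (c : ι → ℝ) (w : Finset ι) : Set (ι → ℝ) :=
  {x | w.piecewise x c ∈ A}

theorem continuous_piecewise (w : Finset ι) (c : ι → ℝ) :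
    Continuous fun x : ι → ℝ => w.piecewise x c := by
  refine continuous_pi fun p => ?_
  by_cases hp : p ∈ w
  · simp only [hp, Finset.piecewise_eq_of_mem]; exact continuous_apply p
  · simp only [hp, not_false_eq_true, Finset.piecewise_eq_of_notMem]; exact continuous_const

theorem piecewise_hybrid (w : Finset ι) (c x : ι → ℝ) (y : w → ℝ) :
    w.piecewise (hybrid w x y) c = hybrid w c y := by
  ext p; by_cases hp : p ∈ w <;> simp [hp, hybrid]

theorem piecewise_update_of_notMem {w : Finset ι} {p : ι} (hp : p ∉ w) (c x : ι → ℝ) (t : ℝ) :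
    w.piecewise (Function.update x p t) c = w.piecewise x c := by
  ext q
  by_cases hq : q ∈ w
  · have : q ≠ p := fun h => hp (h ▸ hq)
    simp [hq, this]
  · simp [hq]

variable {A : Set (ι → ℝ)} {c : ι → ℝ}

theorem isClosed_sliceCylinder (hA : IsClosed A) (w : Finset ι) :
    IsClosed (sliceCylinder A c w) := hA.preimage (continuous_piecewise w c)

theorem volume_frontier_sliceCylinder [Fintype ι]
    (hA : ∀ z ∈ A, {y : ι → ℝ | ∀ p, y p ∈ uIcc (c p) (z p)} ⊆ A) (w : Finset ι) :
    volume (frontier (sliceCylinder A c w)) = 0 := by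
  refine volume_frontier_eq_zero (c := c) fun x hx y hy => hA _ hx fun p => ?_
  by_cases hp : p ∈ w
  · simpa [hp] using hy p
  · simp [hp]

theorem mem_frontier_sliceCylinder_congr {w : Finset ι} {x x' : ι → ℝ}
    (h : ∀ p ∈ w, x p = x' p) :
    x ∈ frontier (sliceCylinder A c w) ↔ x' ∈ frontier (sliceCylinder A c w) := by
  let e : (ι → ℝ) ≃ₜ (ι → ℝ) := Homeomorph.addRight (x' - x)
  have hpre : e ⁻¹' sliceCylinder A c w = sliceCylinder A c w := by
    ext z
    have : w.piecewise (z + (x' - x)) c = w.piecewise z c := by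
      ext p; by_cases hp : p ∈ w <;> simp [hp, h]
    change w.piecewise (z + (x' - x)) c ∈ A ↔ w.piecewise z c ∈ A
    rw [this]
  have h2 := e.preimage_frontier (sliceCylinder A c w)
  rw [hpre] at h2
  have : e x = x' := by simp [e]
  rw [← h2, mem_preimage, this, h2]

theorem continuousAt_comp_piecewise {D : (ι → ℝ) → ℝ} (hD : ContinuousOn D A) (hA : IsClosed A)
    (h0 : ∀ x ∉ A, D x = 0) {w : Finset ι} {x : ι → ℝ}
    (hx : x ∉ frontier (sliceCylinder A c w)) :
    ContinuousAt (fun x => D (w.piecewise x c)) x := by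
  by_cases hxc : x ∈ sliceCylinder A c w
  · have hxi : x ∈ interior (sliceCylinder A c w) := by
      by_contra h; exact hx ⟨subset_closure hxc, h⟩
    have h1 : ContinuousOn (fun x => D (w.piecewise x c)) (sliceCylinder A c w) :=
      ContinuousOn.comp (t := A) hD (continuous_piecewise w c).continuousOn fun _ hy => hy
    exact h1.continuousAt (mem_interior_iff_mem_nhds.1 hxi)
  · have h1 : (fun x => D (w.piecewise x c)) =ᶠ[nhds x] fun _ => 0 := by
      filter_upwards [(isClosed_sliceCylinder hA w).isOpen_compl.mem_nhds hxc] with y hy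
      exact h0 _ hy
    exact continuousAt_const.congr h1.symm

theorem IsSobolExtensible.update_mem (h : IsSobolExtensible A c) {x : ι → ℝ} (hx : x ∈ A) {p : ι}
    {t : ℝ} (ht : Function.update x p t ∈ A) {r : ℝ} (hr : r ∈ uIcc t (x p)) :
    Function.update x p r ∈ A := by
  have key : ∀ q, Function.update x p q ∈ A → r ∈ uIcc (c p) q → Function.update x p r ∈ A := by
    intro q hq hrq
    refine h.2.2.2 _ hq fun i => ?_
    by_cases hi : i = p
    · subst hi; simpa using hrq
    · simp [hi]
  rcases uIcc_subset_uIcc_union_uIcc (b := c p) hr with h1 | h1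
  · exact key t ht (by rwa [uIcc_comm])
  · exact key (x p) (by simpa using hx) h1

end Anchored

section Sobol

variable {s d : ℕ} {A : Set (Pt s d)} {c : Pt s d} {g : Pt s d → ℝ}
  {D : Finset (Fin s × Fin d) → Pt s d → ℝ}

/-- The Sobol' extension in terms of the derivatives within `A`. -/
theorem sobolExtension_eq
    (hc : ∀ z ∈ A, {y : Pt s d | ∀ p, y p ∈ uIcc (c p) (z p)} ⊆ A)
    (h0 : EqOn (D ∅) g A) (hD0 : ∀ T, ∀ x ∉ A, D T x = 0)
    (hd : ∀ v, ∀ p ∉ v, ∀ x ∈ A, HasPartialWithin A p (D v) (D (insert p v) x) x) (x : Pt s d) :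
    sobolExtension A c g x = ∑ w, signedIntegral w c x (fun z => D w (w.piecewise z c)) x := by
  unfold sobolExtension
  refine Finset.sum_congr rfl fun w _ => ?_
  unfold signedIntegral
  have hcard : (-1 : ℝ) ^ (@Finset.filter _ (fun p => x p < c p)
      (fun _ => Classical.propDecidable _) w).card =
      (-1 : ℝ) ^ (w.filter (fun p => x p < c p)).card := by congr!
  rw [hcard]
  congr 1
  refine integral_congr_ae (ae_restrict_of_ae ?_)
  have hfr : ∀ᵐ y : w → ℝ, hybrid w c y ∉ frontier (sliceCylinder A c w) := by
    have h1 := ae_ae_hybrid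
      (measure_eq_zero_iff_ae_notMem.1 (volume_frontier_sliceCylinder hc w)) w
    obtain ⟨z, hz⟩ := h1.exists
    filter_upwards [hz] with y hy
    rwa [mem_frontier_sliceCylinder_congr (x' := hybrid w z y) fun p hp => by
      rw [hybrid_of_mem hp, hybrid_of_mem hp]]
  filter_upwards [hfr] with y hy
  rw [piecewise_hybrid]
  by_cases hyA : hybrid w c y ∈ A
  · rw [indicator_of_mem hyA]
    let O : Set (Pt s d) := {z | (∀ p ∉ w, z p = c p) ∧ z ∈ interior (sliceCylinder A c w)}
    have hpw : ∀ z : Pt s d, (∀ p ∉ w, z p = c p) → w.piecewise z c = z := fun z hz => by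
      ext p; by_cases hp : p ∈ w <;> simp [hp, hz]
    have hOA : O ⊆ A := fun z hz => by
      have : z ∈ sliceCylinder A c w := interior_subset hz.2
      change w.piecewise z c ∈ A at this
      rwa [hpw z hz.1] at this
    have hyO : hybrid w c y ∈ O := by
      have h1 : ∀ p ∉ w, hybrid w c y p = c p := fun p hp => hybrid_of_notMem hp _ _
      refine ⟨h1, ?_⟩
      by_contra h
      refine hy ⟨subset_closure ?_, h⟩
      change w.piecewise _ c ∈ A
      rwa [hpw _ h1]
    rw [mixedPartial_eq_foldr, foldr_pderiv_eq h0 hd hOA (w := w) (fun z hz p hp => ?_)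
      (coordList w) (nodup_coordList w) (fun p hp => mem_coordList.1 hp) _ hyO,
      toFinset_coordList]
    have h2 : Filter.Tendsto (fun t => Function.update z p t) (nhds (z p)) (nhds z) := by
      have h3 : Continuous fun t => Function.update z p t :=
        continuous_const.update p continuous_id
      simpa using h3.tendsto (z p)
    filter_upwards [h2.eventually (isOpen_interior.mem_nhds hz.2)] with t ht
    refine ⟨fun q hq => ?_, ht⟩
    rw [Function.update_of_ne (by rintro rfl; exact hq hp)]
    exact hz.1 q hq
  · rw [indicator_of_notMem hyA, hD0 w _ hyA]

/-- The partial derivatives of the Sobol' extension. -/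
def sobolPartial (c : Pt s d) (D : Finset (Fin s × Fin d) → Pt s d → ℝ)
    (T : Finset (Fin s × Fin d)) (x : Pt s d) : ℝ :=
  ∑ w, partialIntegral w T c (fun z => D w (w.piecewise z c)) x

theorem sobolPartial_empty (x : Pt s d) :
    sobolPartial c D ∅ x =
      ∑ w, signedIntegral w c x (fun z => D w (w.piecewise z c)) x := by
  simp [sobolPartial, partialIntegral]

/-- The points at which the Sobol' extension has a mixed partial derivative in `T`. -/
def IsGoodPoint (A : Set (Pt s d)) (c : Pt s d) (T : Finset (Fin s × Fin d)) (x : Pt s d) : Prop :=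
  ∀ w : Finset (Fin s × Fin d), ∀ᵐ y : ↥(w \ T) → ℝ,
    hybrid (w \ T) x y ∉ frontier (sliceCylinder A c w)

theorem IsGoodPoint.update {T : Finset (Fin s × Fin d)} {x : Pt s d} (h : IsGoodPoint A c T x)
    {p : Fin s × Fin d} (hp : p ∉ T) (t : ℝ) : IsGoodPoint A c T (Function.update x p t) := by
  intro w
  filter_upwards [h w] with y hy
  by_cases hpw : p ∈ w
  · rwa [hybrid_update_of_mem (by simp [hp, hpw])]
  · rw [hybrid_update_of_notMem (by simp [hpw])]
    rwa [mem_frontier_sliceCylinder_congr (x' := hybrid (w \ T) x y)]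
    intro q hq
    rw [Function.update_of_ne]; rintro rfl; exact hpw hq

theorem ae_isGoodPoint (hc : ∀ z ∈ A, {y : Pt s d | ∀ p, y p ∈ uIcc (c p) (z p)} ⊆ A) :
    ∀ᵐ x, ∀ T, IsGoodPoint A c T x := by
  refine ae_all_iff.2 fun T => ae_all_iff.2 fun w => ?_
  exact ae_ae_hybrid (measure_eq_zero_iff_ae_notMem.1 (volume_frontier_sliceCylinder hc w)) (w \ T)

variable {K : ℝ}

theorem foldr_pderiv_sobolPartial (hA : IsClosed A) (hm : ∀ T, Measurable (D T))
    (hK : ∀ T x, |D T x| ≤ K) (hcont : ∀ T, ContinuousOn (D T) A)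
    (hD0 : ∀ T, ∀ x ∉ A, D T x = 0) :
    ∀ (l : List (Fin s × Fin d)), l.Nodup → ∀ x, (∀ T ⊆ l.toFinset, IsGoodPoint A c T x) →
      l.foldr pderiv (sobolPartial c D ∅) x = sobolPartial c D l.toFinset x := by
  intro l
  induction l with
  | nil => intro _ x _; rfl
  | cons p l ih =>
    intro hl x hx
    rw [List.nodup_cons] at hl
    have hp : p ∉ l.toFinset := by simpa using hl.1
    rw [List.toFinset_cons] at hx ⊢
    have h1 : (fun t => l.foldr pderiv (sobolPartial c D ∅) (Function.update x p t)) =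
        fun t => sobolPartial c D l.toFinset (Function.update x p t) := by
      ext t
      exact ih hl.2 _ fun T hT => (hx T (hT.trans (Finset.subset_insert _ _))).update
        (fun h => hp (hT h)) t
    have h2 : HasDerivAt (fun t => sobolPartial c D l.toFinset (Function.update x p t))
        (sobolPartial c D (insert p l.toFinset) x) (x p) := by
      refine HasDerivAt.fun_sum fun w _ => ?_
      refine hasDerivAt_partialIntegral c ((hm w).comp (continuous_piecewise w c).measurable)
        (fun _ => hK w _) (fun q hq z t => ?_) hp ?_
      · simp only [Function.comp_apply, piecewise_update_of_notMem hq]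
      · filter_upwards [hx _ subset_rfl w] with y hy
        exact continuousAt_comp_piecewise (hcont w) hA (hD0 w) hy
    simp only [List.foldr_cons, pderiv]
    rw [h1, h2.deriv]

theorem isIntegralFamily_sobolPartial (hm : ∀ T, Measurable (D T)) (hK : ∀ T x, |D T x| ≤ K) :
    IsIntegralFamily univ (sobolPartial c D) := by
  intro T p hp x _ r _
  have hm' : ∀ w : Finset (Fin s × Fin d), Measurable fun z => D w (w.piecewise z c) := fun w =>
    (hm w).comp (continuous_piecewise w c).measurable
  unfold sobolPartial
  rw [← Finset.sum_sub_distrib, intervalIntegral.integral_finsetSum fun w _ =>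
    intervalIntegrable_partialIntegral' c (hm' w) (fun _ => hK w _) x r (x p)]
  refine Finset.sum_congr rfl fun w _ => ?_
  exact partialIntegral_sub c (hm' w) (fun _ => hK w _) (fun q hq z t => by
    rw [piecewise_update_of_notMem hq]) hp x r

theorem exists_bound_sobolPartial (hK : ∀ T x, |D T x| ≤ K) {R : Set (Pt s d)}
    (hR : IsCompact R) : ∃ L, ∀ T, ∀ x ∈ R, |sobolPartial c D T x| ≤ L := by
  have hcont : Continuous fun x : Pt s d => ∑ T : Finset (Fin s × Fin d),
      ∑ w : Finset (Fin s × Fin d), |K| * ∏ p ∈ w \ T, |x p - c p| := by fun_prop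
  obtain ⟨L, hL⟩ := hR.exists_bound_of_continuousOn hcont.continuousOn
  refine ⟨L, fun T x hx => le_trans ?_ ((le_abs_self _).trans (hL x hx))⟩
  have hnn : ∀ T w : Finset (Fin s × Fin d), 0 ≤ |K| * ∏ p ∈ w \ T, |x p - c p| := fun T w =>
    mul_nonneg (abs_nonneg _) (Finset.prod_nonneg fun _ _ => abs_nonneg _)
  refine le_trans ?_ (Finset.single_le_sum (f := fun T : Finset (Fin s × Fin d) =>
    ∑ w : Finset (Fin s × Fin d), |K| * ∏ p ∈ w \ T, |x p - c p|)
    (fun T _ => Finset.sum_nonneg fun w _ => hnn T w) (Finset.mem_univ T))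
  refine (Finset.abs_sum_le_sum_abs _ _).trans (Finset.sum_le_sum fun w _ => ?_)
  unfold partialIntegral
  split_ifs
  · exact abs_signedIntegral_le (Filter.Eventually.of_forall fun y _ =>
      (hK w _).trans (le_abs_self K))
  · rw [abs_zero]; exact hnn T w

/-- The Sobol' extension agrees with the function on `A`. -/
theorem sobolPartial_empty_eqOn (hc : ∀ z ∈ A, {y : Pt s d | ∀ p, y p ∈ uIcc (c p) (z p)} ⊆ A)
    (h0 : EqOn (D ∅) g A) (hm : ∀ T, Measurable (D T)) (hK : ∀ T x, |D T x| ≤ K)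
    (hcont : ∀ T, ContinuousOn (D T) A)
    (hd : ∀ v, ∀ p ∉ v, ∀ x ∈ A, HasPartialWithin A p (D v) (D (insert p v) x) x) :
    EqOn (sobolPartial c D ∅) g A := by
  intro x hx
  rw [← h0 hx, sobolPartial_empty, (isIntegralFamily_of_hasPartialWithin hcont hd).expansion hm hK hc
    Finset.univ ∅ (by simp) x hx, Finset.powerset_univ]
  refine Finset.sum_congr rfl fun w _ => signedIntegral_congr (fun _ _ => rfl) fun y _ => ?_
  rw [piecewise_hybrid]
  simp

end Sobol

section CaseOne

variable {s d b : ℕ} {X : Fin s → Set (EuclideanSpace ℝ (Fin d))}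
  (S : ∀ j, RecursiveSplit b (X j)) (u : Finset (Fin s)) (κ : u → ℕ)

theorem ofReal_sigmaSq_le_of_isSobolExtensible (hd : 1 ≤ d) (hb : 2 ≤ b)
    (hX : ∀ j, Bornology.IsBounded (X j)) (h1 : ∀ j, volume (X j) = 1) {C : ℝ} (hC : 1 ≤ C)
    (hdiam : ∀ j k (t : Fin k → Fin b),
      Metric.diam ((S j).cell k t) ≤ C * (b : ℝ) ^ (-(k : ℝ) / (d : ℝ)))
    {c : Pt s d} (hS : IsSobolExtensible (prodSet X) c) {f : Pt s d → ℝ}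
    (hf : SmoothOn (prodSet X) f) :
    ENNReal.ofReal (sigmaSq S f u κ) ≤
      ENNReal.ofReal
        ((((d : ℝ) ^ (1 / 2 : ℝ) * (2 ^ d - 1) * C ^ d) ^ 2 * (2 - 2 / (b : ℝ)) ^ 3) ^ u.card *
          (b : ℝ) ^ (-2 * ((∑ j, κ j : ℕ) : ℝ) / (d : ℝ))) *
        hNorm S u κ (sobolExtension (prodSet X) c (anova X f u)) ^ 2 := by
  have hA : IsCompact (prodSet X) :=
    Metric.isCompact_of_isClosed_isBounded hS.1 (isBounded_prodSet hX)
  have hsub := subset_rectHull (isBounded_prodSet hX)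
  set R := rectHull (prodSet X) with hR
  have hRc : IsCompact R := isCompact_Icc
  obtain ⟨D, h0, hm, ⟨K, hK⟩, hcont, hD0, hder⟩ :=
    (SmoothOn.anova (fun j => (S j).measurableSet) h1 hA
      (fun p x hx t ht r hr => hS.update_mem hx ht hr) hf u).exists_family hA
  have hext : sobolExtension (prodSet X) c (anova X f u) = sobolPartial c D ∅ := by
    ext x
    rw [sobolExtension_eq hS.2.2.2 h0 hD0 hder, sobolPartial_empty]
  obtain ⟨L, hL⟩ := exists_bound_sobolPartial (c := c) hK hRc
  have hind : ∀ T, EqOn (R.indicator (sobolPartial c D T)) (sobolPartial c D T) R :=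
    fun T x hx => indicator_of_mem hx _
  refine ofReal_sigmaSq_le S u κ hd hb hX h1 hC hdiam
    (fun τ γ => setIntegral_mul_psi_eq_anova S u κ τ γ hb h1 hA hf.continuousOn)
    (G := fun T => R.indicator (sobolPartial c D T)) (K := |L|) (fun T => ?_) (fun T x => ?_)
    ?_ ?_ fun T => ?_
  · refine Measurable.indicator (Finset.measurable_sum _ fun w _ => ?_) (measurableSet_rectHull _)
    exact measurable_partialIntegral c ((hm w).comp (continuous_piecewise w c).measurable)
  · by_cases hx : x ∈ R
    · simp only [hind T hx]; exact (hL T x hx).trans (le_abs_self L)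
    · simp [hx]
  · intro T p hp x hx r hr
    have h2 := isIntegralFamily_sobolPartial (c := c) hm hK T p hp x (mem_univ _) r
      fun _ _ => mem_univ _
    simp only [hind T hx, hind T (hr r left_mem_uIcc)]
    rw [h2]
    exact intervalIntegral.integral_congr fun t ht => (hind _ (hr t ht)).symm
  · exact ((hind ∅).mono hsub).trans (sobolPartial_empty_eqOn hS.2.2.2 h0 hm hK hcont hder)
  · filter_upwards [ae_isGoodPoint hS.2.2.2] with x hx hxR
    rw [hext, mixedPartial_eq_foldr, foldr_pderiv_sobolPartial hS.1 hm hK hcont hD0 _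
      (nodup_coordList T) x fun T _ => hx T, toFinset_coordList]
    exact (hind T hxR).symm

end CaseOne

end

end ScrambledGeometric

theorem mainTheorem6 (s d b : ℕ) (hd : 1 ≤ d) (hb : 2 ≤ b)
    (X : Fin s → Set (EuclideanSpace ℝ (Fin d)))
    (hX_bdd : ∀ j, Bornology.IsBounded (X j))
    (hX_vol : ∀ j, MeasureTheory.volume (X j) = 1)
    (S : ∀ j, ScrambledGeometric.RecursiveSplit b (X j))
    (C : ℝ) (hC : 1 ≤ C)
    (hdiam : ∀ j k (t : Fin k → Fin b),
      Metric.diam ((S j).cell k t) ≤ C * (b : ℝ) ^ (-(k : ℝ) / (d : ℝ)))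
    (f : ScrambledGeometric.Pt s d → ℝ) (u : Finset (Fin s)) (κ : u → ℕ) :
    (∀ c : ScrambledGeometric.Pt s d,
      ScrambledGeometric.IsSobolExtensible (ScrambledGeometric.prodSet X) c →
      ScrambledGeometric.SmoothOn (ScrambledGeometric.prodSet X) f →
      ENNReal.ofReal (ScrambledGeometric.sigmaSq S f u κ) ≤
        ENNReal.ofReal
          ((((d : ℝ) ^ (1 / 2 : ℝ) * (2 ^ d - 1) * C ^ d) ^ 2 * (2 - 2 / (b : ℝ)) ^ 3) ^ u.card *
            (b : ℝ) ^ (-2 * ((∑ j, κ j : ℕ) : ℝ) / (d : ℝ))) *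
          ScrambledGeometric.hNorm S u κ
            (ScrambledGeometric.sobolExtension (ScrambledGeometric.prodSet X) c
              (ScrambledGeometric.anova X f u)) ^ 2) ∧
    ((∀ j, IsClosed (X j)) → (∀ j, (interior (X j)).Nonempty) →
      (∀ j, MeasureTheory.volume (frontier (X j)) = 0) →
      ScrambledGeometric.CmOn (s * d) (ScrambledGeometric.prodSet X) f →
      ∀ F : ScrambledGeometric.Pt s d → ℝ,
        ScrambledGeometric.IsCmExtension (s * d) (ScrambledGeometric.prodSet X)
          (ScrambledGeometric.anova X f u) F →
        ENNReal.ofReal (ScrambledGeometric.sigmaSq S f u κ) ≤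
          ENNReal.ofReal
            ((((d : ℝ) ^ (1 / 2 : ℝ) * (2 ^ d - 1) * C ^ d) ^ 2 * (2 - 2 / (b : ℝ)) ^ 3) ^ u.card *
              (b : ℝ) ^ (-2 * ((∑ j, κ j : ℕ) : ℝ) / (d : ℝ))) *
            ScrambledGeometric.hNorm S u κ F ^ 2) := by
  refine ⟨fun c hS hf => ?_, fun hcl hint _ hf F hF => ?_⟩
  · exact ScrambledGeometric.ofReal_sigmaSq_le_of_isSobolExtensible S u κ hd hb hX_bdd hX_vol hC
      hdiam hS hf
  · exact ScrambledGeometric.ofReal_sigmaSq_le_of_isCmExtension S u κ hd hb hX_bdd hX_vol hC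
      hdiam hcl hint hf.continuousOn hF
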